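/- Let $n\in\mathbb{N}=\{0,1,2,\dots\}$, $\ell=\frac{2n+1}{2}$, $N=2\ell=2n+1$. **The weight.** For $k\in\frac12\mathbb N$ let $T^{k}$ be the unitary representation $p\mapsto p\circ g^{t}$ $(g\in \mathrm{SU}(2))$ on the space $H^k$ of homogeneous polynomials of degree $2k$ in $x,y$, with orthonormal basis $\psi^k_j=\binom{2k}{k-j}^{1/2}x^{k-j}y^{k+j}$, $j=-k,\dots,k$. For $p\in\{-\ell,\dots,\ell\}$ put $(\ell_1,\ell_2)=(\frac{\ell+p}{2},\frac{\ell-p}{2})$, let $\beta_p:H^\ell\to H^{\ell_1}\otimes H^{\ell_2}$ be the isometric $\mathrm{SU}(2)$-intertwiner given by the Clebsch–Gordan coefficients, and let $\Phi_p(g_1,g_2)=\beta_p^*\,(T^{\ell_1}(g_1)\otimes T^{\ell_2}(g_2))\,\beta_p$. With $m_t=\mathrm{diag}(e^{it/2},e^{-it/2})$ and $a_t=(m_t,m_{-t})$ let $\Phi_0^\ell(a_t)$ be the matrix with entries $(\Phi_0^\ell(a_t))_{p,q}=(\Phi_p(a_t))_{q,q}$, $p,q\in\{-\ell,\dots,\ell\}$,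 and $V(a_t)=\sin^2(t)\,\Phi_0^\ell(a_t)\Phi_0^\ell(a_t)^*$. The $(N+1)\times(N+1)$ matrix weight $W$ on $[-1,1]$ is given by $$\sqrt{1-x^2}\;W(x)_{i,j}=V(a_{\arccos x})_{-\ell+i,-\ell+j}\quad(|x|<1),\qquad W(\pm1)=0,\qquad i,j\in\{0,\dots,N\}.$$ **Notation.** $J=J_{n+1}$ and $F=F_{n+1}$ are the $(n+1)\times(n+1)$ matrices $J_{i,j}=\delta_{j,n-i}$, $F_{i,j}=(-1)^i\delta_{i,j}$ $(0\le i,j\le n)$; $X^{t}$ is the transpose and $X^{d}$ the reflection of $X$ in its antidiagonal; $Y=\frac1{\sqrt2}\begin{pmatrix} I & J\\ -J& I\end{pmatrix}$. A matrix weight on $(-1,1)$ is a matrix function that is integrable with finite moments of all orders and positive definite almost everywhere. A sequence of monic orthogonal polynomials with respect to a matrix weight $w$ is a sequence $(P_d)_{d\ge0}$ of polynomials with complex matrix coefficients, $P_d$ monic of degree $d$, with $\int_{-1}^1P_d(x)w(x)P_e(x)^*dx=0$ for $d\neq e$. **Statement.** Let $A(x)$ and $B(x)$ be the upper left and upper right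 $(n+1)\times(n+1)$ blocks of $W(x)$. Then for all $x\in[-1,1]$ we have $A(x)^t=A(x)$, $$W(x)=\begin{pmatrix}A(x)&B(x)\\ B(x)^{dt}&A(x)^{dt}\end{pmatrix}\qquad\text{and}\qquad Y\,W(x)\,Y^t=\begin{pmatrix}W_1(x)&0\\0&W_2(x)\end{pmatrix},$$ where $$W_1(x)=A(x)+B(x)J,\qquad W_2(x)=JF\,W_1(-x)\,FJ .$$ Both $W_1$ and $W_2$ are matrix weights on $(-1,1)$. There is a unique sequence $(P_{d,1})_{d\ge0}$ of monic orthogonal polynomials with respect to $W_1$, and $$P_{d,2}(x)=(-1)^d\,JF\,P_{d,1}(-x)\,FJ,\qquad d\ge 0,$$ is the unique sequence of monic orthogonal polynomials with respect to $W_2$. -/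

import Mathlib

open scoped Matrix Kronecker ComplexOrder

noncomputable section

namespace SU2MVOP

/-! ### Representations of `SU(2)` -/

/-- The group `K = SU(2)`. -/
abbrev K : Type := Matrix.specialUnitaryGroup (Fin 2) ℂ

/-- The action `p ↦ p ∘ gᵗ` of a `2 × 2` matrix `g` on polynomials in the two variables
`x = X 0`, `y = X 1`: the `i`-th coordinate of `gᵗ (x, y)` is `∑ j, g j i * X j`. -/
def act (g : Matrix (Fin 2) (Fin 2) ℂ) :
    MvPolynomial (Fin 2) ℂ →ₐ[ℂ] MvPolynomial (Fin 2) ℂ :=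
  MvPolynomial.aeval fun i => ∑ j, MvPolynomial.C (g j i) * MvPolynomial.X j

/-- The standard orthonormal weight basis of `H^ℓ = ℂ[x, y]_{2ℓ}`, with `N = 2ℓ` and the weight
`j ∈ {-ℓ, …, ℓ}` recorded by `a = ℓ + j ∈ {0, …, N}`:
`ψ^ℓ_j = binom(2ℓ, ℓ + j)^{1/2} x^{ℓ - j} y^{ℓ + j}`. -/
def psi (N a : ℕ) : MvPolynomial (Fin 2) ℂ :=
  MvPolynomial.C ((Real.sqrt (N.choose a) : ℝ) : ℂ) *
    (MvPolynomial.X 0 ^ (N - a) * MvPolynomial.X 1 ^ a)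

/-- The `a`-th coordinate, in the basis `psi N 0, …, psi N N`, of a polynomial that is
homogeneous of degree `N`. -/
def coord (N a : ℕ) (p : MvPolynomial (Fin 2) ℂ) : ℂ :=
  p.coeff (Finsupp.single 0 (N - a) + Finsupp.single 1 a) / ((Real.sqrt (N.choose a) : ℝ) : ℂ)

/-- The matrix, in the orthonormal basis `psi N`, of the representation `T^ℓ` on `H^ℓ`,
`N = 2ℓ`. -/
def rep (N : ℕ) (g : Matrix (Fin 2) (Fin 2) ℂ) : Matrix (Fin (N + 1)) (Fin (N + 1)) ℂ :=
  Matrix.of fun a b => coord N a (act g (psi N b))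

/-- The matrix of the outer tensor product representation `T^{ℓ₁, ℓ₂}` of `U = K × K` on
`H^{ℓ₁} ⊗ H^{ℓ₂}`, with `N₁ = 2ℓ₁`, `N₂ = 2ℓ₂`. -/
def repU (N₁ N₂ : ℕ) (u : K × K) :
    Matrix (Fin (N₁ + 1) × Fin (N₂ + 1)) (Fin (N₁ + 1) × Fin (N₂ + 1)) ℂ :=
  rep N₁ u.1.1 ⊗ₖ rep N₂ u.2.1

/-- `β` is an isometric intertwiner `H^ℓ → H^{ℓ₁} ⊗ H^{ℓ₂}` for the action of `K`, embedded
diagonally in `K × K`. Here `N = 2ℓ`, `N₁ = 2ℓ₁`, `N₂ = 2ℓ₂`. -/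
def IsIsometricIntertwiner {N N₁ N₂ : ℕ}
    (β : Matrix (Fin (N₁ + 1) × Fin (N₂ + 1)) (Fin (N + 1)) ℂ) : Prop :=
  βᴴ * β = 1 ∧ ∀ k : K, repU N₁ N₂ (k, k) * β = β * rep N k.1

/-- The Clebsch-Gordan matrix `β_ℓ^{ℓ₁, ℓ₂} : H^ℓ → H^{ℓ₁} ⊗ H^{ℓ₂}` for `ℓ = ℓ₁ + ℓ₂`. -/
def clebschGordan (N N₁ N₂ : ℕ) :
    Matrix (Fin (N₁ + 1) × Fin (N₂ + 1)) (Fin (N + 1)) ℂ :=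
  Matrix.of fun p q =>
    if (p.1 : ℕ) + (p.2 : ℕ) = (q : ℕ) then
      ((Real.sqrt ((N₁.choose p.1 * N₂.choose p.2 : ℝ) / N.choose q) : ℝ) : ℂ)
    else 0

open MvPolynomial in
lemma coeff_mul_pow (M b a : ℕ) (p q r t : ℂ) :
    ((C p * X 0 + C q * X 1) ^ M * (C r * X 0 + C t * X 1) ^ b : MvPolynomial (Fin 2) ℂ).coeff
        (Finsupp.single 0 (M + b - a) + Finsupp.single 1 a) =
    ∑ s ∈ Finset.range (b + 1), ∑ i ∈ Finset.range (M + 1), if i + s = a then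
      (M.choose i : ℂ) * b.choose s * (p ^ (M - i) * q ^ i * r ^ (b - s) * t ^ s) else 0 := by
  rw [add_comm (C p * X 0), add_comm (C r * X 0), add_pow, add_pow, Finset.sum_mul_sum,
    Finset.sum_comm, coeff_sum]
  refine Finset.sum_congr rfl fun s hs => ?_
  rw [coeff_sum]
  refine Finset.sum_congr rfl fun i hi => ?_
  simp only [Finset.mem_range] at hs hi
  have h : ((C q * X 1) ^ i * (C p * X 0) ^ (M - i) * (M.choose i : MvPolynomial (Fin 2) ℂ) *
      ((C t * X 1) ^ s * (C r * X 0) ^ (b - s) * (b.choose s : MvPolynomial (Fin 2) ℂ))) =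
      monomial (Finsupp.single 0 (M + b - (i + s)) + Finsupp.single 1 (i + s))
        ((M.choose i : ℂ) * b.choose s * (p ^ (M - i) * q ^ i * r ^ (b - s) * t ^ s)) := by
    have e : M + b - (i + s) = (M - i) + (b - s) := by omega
    rw [e, monomial_eq, Finsupp.prod_add_index' (by simp) (by intros; rw [pow_add])]
    simp only [Finsupp.prod_single_index, pow_zero, map_mul, map_pow, map_natCast]
    ring
  rw [h, coeff_monomial]
  refine if_congr ⟨fun h => ?_, fun h => by rw [h]⟩ rfl rfl
  simpa using DFunLike.congr_fun h 1

lemma choose_symm_aux (s i j k : ℕ) :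
    (s + i + j + k).choose (s + j) * ((i + k).choose i * (s + j).choose s) =
      (s + i + j + k).choose (s + i) * ((j + k).choose j * (s + i).choose s) := by
  have F (a b : ℕ) : (a + b).choose a * a.factorial * b.factorial = (a + b).factorial := by
    rw [Nat.choose_symm_add]; exact Nat.add_choose_mul_factorial_mul_factorial a b
  have h1 := F (s + j) (i + k)
  have h2 := F (s + i) (j + k)
  have h3 := F s j
  have h4 := F s i
  have h5 := F i k
  have h6 := F j k
  rw [show s + j + (i + k) = s + i + j + k by ring, ← h3, ← h5] at h1
  rw [show s + i + (j + k) = s + i + j + k by ring, ← h4, ← h6] at h2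
  have hp : 0 < s.factorial * i.factorial * j.factorial * k.factorial := by positivity
  apply Nat.eq_of_mul_eq_mul_right hp
  calc _ = (s + i + j + k).factorial := by rw [← h1]; ring
    _ = _ := by rw [← h2]; ring

lemma act_psi_eq (N b : ℕ) (g : Matrix (Fin 2) (Fin 2) ℂ) :
    act g (psi N b) = MvPolynomial.C ((Real.sqrt (N.choose b) : ℝ) : ℂ) *
      ((MvPolynomial.C (g 0 0) * MvPolynomial.X 0 + MvPolynomial.C (g 1 0) * MvPolynomial.X 1) ^
          (N - b) *
        (MvPolynomial.C (g 0 1) * MvPolynomial.X 0 + MvPolynomial.C (g 1 1) * MvPolynomial.X 1) ^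
          b) := by
  simp [act, psi, Fin.sum_univ_two, MvPolynomial.algebraMap_eq]

lemma sqrt_choose_ne (N a : ℕ) (ha : a ≤ N) : ((Real.sqrt (N.choose a) : ℝ) : ℂ) ≠ 0 := by
  have : 0 < N.choose a := Nat.choose_pos ha
  exact_mod_cast (Real.sqrt_pos.2 (by exact_mod_cast this)).ne'

lemma sqrt_choose_sq (N a : ℕ) :
    ((Real.sqrt (N.choose a) : ℝ) : ℂ) * ((Real.sqrt (N.choose a) : ℝ) : ℂ) = N.choose a := by
  rw [← Complex.ofReal_mul, Real.mul_self_sqrt (by positivity)]; simp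

/-- The matrix of `gᵗ` is the transposed matrix of `g`. -/
lemma rep_transpose (N : ℕ) (g : Matrix (Fin 2) (Fin 2) ℂ) : (rep N g)ᵀ = rep N gᵀ := by
  ext ⟨a, ha⟩ ⟨b, hb⟩
  have ha' : a ≤ N := by omega
  have hb' : b ≤ N := by omega
  simp only [rep, Matrix.transpose_apply, Matrix.of_apply, coord, act_psi_eq,
    MvPolynomial.coeff_C_mul]
  have ea : N - b = N - a + a - b := by omega
  have eb : N - a = N - b + b - a := by omega
  have key : (N.choose a : ℂ) * ((MvPolynomial.C (g 0 0) * MvPolynomial.X (0 : Fin 2) +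
        MvPolynomial.C (g 1 0) * MvPolynomial.X 1) ^ (N - a) *
        (MvPolynomial.C (g 0 1) * MvPolynomial.X (0 : Fin 2) + MvPolynomial.C (g 1 1) * MvPolynomial.X 1) ^
          a).coeff (Finsupp.single (0 : Fin 2) (N - b) + Finsupp.single (1 : Fin 2) b) =
      (N.choose b : ℂ) * ((MvPolynomial.C (g 0 0) * MvPolynomial.X (0 : Fin 2) +
        MvPolynomial.C (g 0 1) * MvPolynomial.X 1) ^ (N - b) *
        (MvPolynomial.C (g 1 0) * MvPolynomial.X (0 : Fin 2) + MvPolynomial.C (g 1 1) * MvPolynomial.X 1) ^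
          b).coeff (Finsupp.single (0 : Fin 2) (N - a) + Finsupp.single (1 : Fin 2) a) := by
    have h1 := coeff_mul_pow (N - a) a b (g 0 0) (g 1 0) (g 0 1) (g 1 1)
    have h2 := coeff_mul_pow (N - b) b a (g 0 0) (g 0 1) (g 1 0) (g 1 1)
    rw [show N - a + a - b = N - b by omega] at h1
    rw [show N - b + b - a = N - a by omega] at h2
    rw [h1, h2, Finset.mul_sum, Finset.mul_sum]
    have hA : ∀ s ∈ Finset.range (a + 1), (N.choose a : ℂ) * (∑ i ∈ Finset.range (N - a + 1),
        if i + s = b then ((N - a).choose i : ℂ) * a.choose s *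
          (g 0 0 ^ (N - a - i) * g 1 0 ^ i * g 0 1 ^ (a - s) * g 1 1 ^ s) else 0) =
        if s ≤ b ∧ a + b ≤ N + s then (N.choose a : ℂ) * (((N - a).choose (b - s) : ℂ) *
          a.choose s * (g 0 0 ^ (N + s - a - b) * g 1 0 ^ (b - s) * g 0 1 ^ (a - s) *
            g 1 1 ^ s)) else 0 := by
      intro s hs
      simp only [Finset.mem_range] at hs
      split_ifs with h
      · rw [Finset.sum_eq_single (b - s)]
        · rw [if_pos (by omega), show N - a - (b - s) = N + s - a - b by omega]
        · intro i _ hi; rw [if_neg (by omega)]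
        · intro hi; exfalso; apply hi; simp only [Finset.mem_range]; omega
      · rw [Finset.sum_eq_zero, mul_zero]
        intro i hi
        simp only [Finset.mem_range] at hi
        rw [if_neg (by omega)]
    have hB : ∀ s ∈ Finset.range (b + 1), (N.choose b : ℂ) * (∑ i ∈ Finset.range (N - b + 1),
        if i + s = a then ((N - b).choose i : ℂ) * b.choose s *
          (g 0 0 ^ (N - b - i) * g 0 1 ^ i * g 1 0 ^ (b - s) * g 1 1 ^ s) else 0) =
        if s ≤ a ∧ a + b ≤ N + s then (N.choose b : ℂ) * (((N - b).choose (a - s) : ℂ) *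
          b.choose s * (g 0 0 ^ (N + s - a - b) * g 0 1 ^ (a - s) * g 1 0 ^ (b - s) *
            g 1 1 ^ s)) else 0 := by
      intro s hs
      simp only [Finset.mem_range] at hs
      split_ifs with h
      · rw [Finset.sum_eq_single (a - s)]
        · rw [if_pos (by omega), show N - b - (a - s) = N + s - a - b by omega]
        · intro i _ hi; rw [if_neg (by omega)]
        · intro hi; exfalso; apply hi; simp only [Finset.mem_range]; omega
      · rw [Finset.sum_eq_zero, mul_zero]
        intro i hi
        simp only [Finset.mem_range] at hi
        rw [if_neg (by omega)]
    rw [Finset.sum_congr rfl hA, Finset.sum_congr rfl hB, ← Finset.sum_filter,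
      ← Finset.sum_filter]
    refine Finset.sum_congr ?_ ?_
    · ext s; simp only [Finset.mem_filter, Finset.mem_range]; omega
    · intro s hs
      simp only [Finset.mem_filter, Finset.mem_range] at hs
      obtain ⟨i, rfl⟩ : ∃ i, a = s + i := ⟨a - s, by omega⟩
      obtain ⟨j, rfl⟩ : ∃ j, b = s + j := ⟨b - s, by omega⟩
      obtain ⟨k, rfl⟩ : ∃ k, N = s + i + j + k := ⟨N - (s + i + j), by omega⟩
      have := choose_symm_aux s i j k
      rw [show s + i + j + k - (s + i) = j + k by omega,
        show s + i + j + k - (s + j) = i + k by omega, show s + i - s = i by omega,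
        show s + j - s = j by omega]
      have h' : ((s + i + j + k).choose (s + j) : ℂ) * ((i + k).choose i * (s + j).choose s) =
        (s + i + j + k).choose (s + i) * ((j + k).choose j * (s + i).choose s) := by
        exact_mod_cast this
      linear_combination (-(g 0 0 ^ (s + i + j + k + s - (s + i) - (s + j)) * g 0 1 ^ i *
        g 1 0 ^ j * g 1 1 ^ s)) * h'
  rw [div_eq_div_iff (sqrt_choose_ne N b hb') (sqrt_choose_ne N a ha')]
  rw [mul_right_comm, sqrt_choose_sq, mul_right_comm, sqrt_choose_sq]
  exact key

lemma coeff_psi (N q p : ℕ) : (psi N q).coeff (Finsupp.single 0 (N - p) + Finsupp.single 1 p) =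
    if q = p then ((Real.sqrt (N.choose q) : ℝ) : ℂ) else 0 := by
  have : psi N q = MvPolynomial.monomial (Finsupp.single 0 (N - q) + Finsupp.single 1 q)
      ((Real.sqrt (N.choose q) : ℝ) : ℂ) := by
    rw [MvPolynomial.monomial_eq, Finsupp.prod_add_index' (by simp) (by intros; rw [pow_add])]
    simp [psi]
  rw [this, MvPolynomial.coeff_monomial]
  refine if_congr ⟨fun h => ?_, fun h => by rw [h]⟩ rfl rfl
  simpa using DFunLike.congr_fun h 1

/-- `rep N g` is the matrix of the action of `g` in the basis `psi N`. -/
lemma act_psi (N : ℕ) (g : Matrix (Fin 2) (Fin 2) ℂ) (b : Fin (N + 1)) :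
    act g (psi N b) = ∑ a : Fin (N + 1), MvPolynomial.C (rep N g a b) * psi N a := by
  have hom : (act g (psi N b)).IsHomogeneous N := by
    rw [act_psi_eq]
    have h := ((((MvPolynomial.isHomogeneous_C_mul_X (g 0 0) (0 : Fin 2)).add
      (MvPolynomial.isHomogeneous_C_mul_X (g 1 0) (1 : Fin 2))).pow (N - b)).mul
      (((MvPolynomial.isHomogeneous_C_mul_X (g 0 1) (0 : Fin 2)).add
      (MvPolynomial.isHomogeneous_C_mul_X (g 1 1) (1 : Fin 2))).pow b))
    have h2 := (MvPolynomial.isHomogeneous_C (Fin 2)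
      ((Real.sqrt (N.choose b) : ℝ) : ℂ)).mul h
    convert h2 using 1
    omega
  ext d
  rw [MvPolynomial.coeff_sum]
  simp only [MvPolynomial.coeff_C_mul]
  by_cases hd : d 0 + d 1 = N
  · have ed : d = Finsupp.single 0 (N - d 1) + Finsupp.single 1 (d 1) := by
      ext i; fin_cases i
      · simp; omega
      · simp
    rw [ed]
    simp only [coeff_psi]
    rw [Finset.sum_eq_single (⟨d 1, by omega⟩ : Fin (N + 1))]
    · simp only [rep, Matrix.of_apply, coord, if_true]
      rw [div_mul_cancel₀ _ (sqrt_choose_ne N (d 1) (by omega))]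
    · intro a _ ha
      rw [if_neg, mul_zero]
      intro h; apply ha; ext; exact h
    · simp
  · rw [hom.coeff_eq_zero, Finset.sum_eq_zero]
    · intro a _
      have : (psi N a).IsHomogeneous N := by
        have h2 := (MvPolynomial.isHomogeneous_C (Fin 2)
          ((Real.sqrt (N.choose a) : ℝ) : ℂ)).mul
          (((MvPolynomial.isHomogeneous_X ℂ (0 : Fin 2)).pow (N - a)).mul
            ((MvPolynomial.isHomogeneous_X ℂ (1 : Fin 2)).pow a))
        unfold psi
        convert h2 using 1
        omega
      rw [this.coeff_eq_zero, mul_zero]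
      simpa [Finsupp.degree_eq_sum, Fin.sum_univ_two] using hd
    · simpa [Finsupp.degree_eq_sum, Fin.sum_univ_two] using hd

lemma psi_mul_psi (N₁ N₂ a b : ℕ) (ha : a ≤ N₁) (hb : b ≤ N₂) :
    psi N₁ a * psi N₂ b = MvPolynomial.C ((Real.sqrt ((N₁.choose a * N₂.choose b : ℝ) /
      (N₁ + N₂).choose (a + b)) : ℝ) : ℂ) * psi (N₁ + N₂) (a + b) := by
  have h : 0 < ((N₁ + N₂).choose (a + b) : ℝ) := by
    exact_mod_cast Nat.choose_pos (by omega)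
  have e : Real.sqrt (N₁.choose a) * Real.sqrt (N₂.choose b) =
      Real.sqrt ((N₁.choose a * N₂.choose b : ℝ) / (N₁ + N₂).choose (a + b)) *
        Real.sqrt ((N₁ + N₂).choose (a + b)) := by
    rw [← Real.sqrt_mul (by positivity), ← Real.sqrt_mul (by positivity),
      div_mul_cancel₀ _ h.ne']
  have e' : MvPolynomial.C (σ := Fin 2) ((Real.sqrt (N₁.choose a) : ℝ) : ℂ) *
      MvPolynomial.C ((Real.sqrt (N₂.choose b) : ℝ) : ℂ) =
      MvPolynomial.C ((Real.sqrt ((N₁.choose a * N₂.choose b : ℝ) /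
      (N₁ + N₂).choose (a + b)) : ℝ) : ℂ) *
      MvPolynomial.C ((Real.sqrt ((N₁ + N₂).choose (a + b)) : ℝ) : ℂ) := by
    rw [← map_mul, ← map_mul, ← Complex.ofReal_mul, ← Complex.ofReal_mul, e]
  unfold psi
  rw [show N₁ + N₂ - (a + b) = (N₁ - a) + (N₂ - b) by omega, pow_add, pow_add]
  linear_combination (MvPolynomial.X 0 ^ (N₁ - a) * MvPolynomial.X 0 ^ (N₂ - b) *
    (MvPolynomial.X 1 ^ a * MvPolynomial.X 1 ^ b)) * e'

lemma coord_add (N a : ℕ) (p q : MvPolynomial (Fin 2) ℂ) :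
    coord N a (p + q) = coord N a p + coord N a q := by
  simp [coord, add_div]

lemma coord_sum {ι : Type} (N a : ℕ) (s : Finset ι) (f : ι → MvPolynomial (Fin 2) ℂ) :
    coord N a (∑ i ∈ s, f i) = ∑ i ∈ s, coord N a (f i) := by
  simp [coord, MvPolynomial.coeff_sum, Finset.sum_div]

lemma coord_C_mul (N a : ℕ) (c : ℂ) (p : MvPolynomial (Fin 2) ℂ) :
    coord N a (MvPolynomial.C c * p) = c * coord N a p := by
  simp [coord, mul_div_assoc]

lemma coord_psi (N : ℕ) (a b : ℕ) (hb : b ≤ N) :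
    coord N a (psi N b) = if b = a then 1 else 0 := by
  unfold coord
  rw [coeff_psi]
  split_ifs with h
  · subst h; exact div_self (sqrt_choose_ne N b hb)
  · simp

lemma coord_psi_mul_psi (N₁ N₂ : ℕ) (p : Fin (N₁ + 1) × Fin (N₂ + 1)) (q : Fin (N₁ + N₂ + 1)) :
    coord (N₁ + N₂) q (psi N₁ p.1 * psi N₂ p.2) = clebschGordan (N₁ + N₂) N₁ N₂ p q := by
  rw [psi_mul_psi _ _ _ _ (by omega) (by omega), coord_C_mul, coord_psi _ _ _ (by omega)]
  simp only [clebschGordan, Matrix.of_apply]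
  split_ifs with h
  · rw [h, mul_one]
  · simp

/-- The transpose of the Clebsch-Gordan matrix, i.e. the normalized multiplication of
polynomials, intertwines the actions. -/
lemma clebschGordan_transpose_mul (N₁ N₂ : ℕ) (g : Matrix (Fin 2) (Fin 2) ℂ) :
    (clebschGordan (N₁ + N₂) N₁ N₂)ᵀ * (rep N₁ g ⊗ₖ rep N₂ g) =
      rep (N₁ + N₂) g * (clebschGordan (N₁ + N₂) N₁ N₂)ᵀ := by
  ext q ⟨p₁, p₂⟩
  have h1 : coord (N₁ + N₂) q (act g (psi N₁ p₁ * psi N₂ p₂)) =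
      ((clebschGordan (N₁ + N₂) N₁ N₂)ᵀ * (rep N₁ g ⊗ₖ rep N₂ g)) q (p₁, p₂) := by
    rw [map_mul, act_psi, act_psi, Finset.sum_mul_sum, ← Finset.sum_product', coord_sum,
      Matrix.mul_apply]
    refine Finset.sum_congr (by ext; simp) fun r _ => ?_
    have e : MvPolynomial.C (rep N₁ g r.1 p₁) * psi N₁ r.1 *
        (MvPolynomial.C (rep N₂ g r.2 p₂) * psi N₂ r.2) =
        MvPolynomial.C (rep N₁ g r.1 p₁ * rep N₂ g r.2 p₂) * (psi N₁ r.1 * psi N₂ r.2) := by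
      rw [map_mul]; ring
    rw [e, coord_C_mul, coord_psi_mul_psi, mul_comm]
    rfl
  have h2 : coord (N₁ + N₂) q (act g (psi N₁ p₁ * psi N₂ p₂)) =
      (rep (N₁ + N₂) g * (clebschGordan (N₁ + N₂) N₁ N₂)ᵀ) q (p₁, p₂) := by
    have hp : (p₁ : ℕ) + (p₂ : ℕ) < N₁ + N₂ + 1 := by omega
    have e : act g (MvPolynomial.C ((Real.sqrt ((N₁.choose p₁ * N₂.choose p₂ : ℝ) /
        (N₁ + N₂).choose (p₁ + p₂)) : ℝ) : ℂ)) = MvPolynomial.C ((Real.sqrt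
        ((N₁.choose p₁ * N₂.choose p₂ : ℝ) / (N₁ + N₂).choose (p₁ + p₂)) : ℝ) : ℂ) := by
      simp [act, MvPolynomial.algebraMap_eq]
    have e' : coord (N₁ + N₂) q (act g (psi (N₁ + N₂) (p₁ + p₂))) =
        rep (N₁ + N₂) g q ⟨(p₁ : ℕ) + p₂, hp⟩ := rfl
    rw [psi_mul_psi _ _ _ _ (by omega) (by omega), map_mul, e, coord_C_mul, e',
      Matrix.mul_apply,
      Finset.sum_eq_single (⟨(p₁ : ℕ) + p₂, hp⟩ : Fin (N₁ + N₂ + 1))]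
    · simp [clebschGordan, mul_comm]
    · intro r _ hr
      rw [Matrix.transpose_apply, clebschGordan, Matrix.of_apply, if_neg, mul_zero]
      exact fun h => hr (Fin.ext h.symm)
    · simp
  rw [← h1, ← h2]

lemma clebschGordan_isometry (N₁ N₂ : ℕ) :
    (clebschGordan (N₁ + N₂) N₁ N₂)ᴴ * clebschGordan (N₁ + N₂) N₁ N₂ = 1 := by
  ext q q'
  rw [Matrix.mul_apply]
  have hv : ∑ p : Fin (N₁ + 1) × Fin (N₂ + 1), (if (p.1 : ℕ) + (p.2 : ℕ) = q then
      ((N₁.choose p.1 : ℝ) * N₂.choose p.2) else 0) = (N₁ + N₂).choose q := by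
    rw [Nat.add_choose_eq, Nat.cast_sum, ← Finset.sum_filter]
    refine Finset.sum_of_injOn (fun p => ((p.1 : ℕ), (p.2 : ℕ))) ?_ ?_ ?_ ?_
    · rintro ⟨a, b⟩ _ ⟨c, d⟩ _ h
      simp only [Prod.mk.injEq] at h
      exact Prod.ext (Fin.ext h.1) (Fin.ext h.2)
    · rintro ⟨a, b⟩ h
      simpa using h
    · rintro ⟨a, b⟩ h h'
      replace h := Finset.HasAntidiagonal.mem_antidiagonal.1 h
      by_cases ha : a < N₁ + 1
      · by_cases hb : b < N₂ + 1
        · exact absurd ⟨(⟨a, ha⟩, ⟨b, hb⟩), by simpa using h, rfl⟩ h'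
        · simp [Nat.choose_eq_zero_of_lt (show N₂ < b by omega)]
      · simp [Nat.choose_eq_zero_of_lt (show N₁ < a by omega)]
    · intro p _; push_cast; rfl
  have hq : ((N₁ + N₂).choose q : ℝ) ≠ 0 := by
    exact_mod_cast (Nat.choose_pos (show (q : ℕ) ≤ N₁ + N₂ by omega)).ne'
  by_cases h : q = q'
  · subst h
    rw [Matrix.one_apply_eq, ← div_self (show ((N₁ + N₂).choose q : ℂ) ≠ 0 by exact_mod_cast hq)]
    have hv' := congrArg (fun r : ℝ => (r : ℂ)) hv
    simp only [Complex.ofReal_sum, Complex.ofReal_natCast] at hv'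
    conv_rhs => rw [← hv', Finset.sum_div]
    refine Finset.sum_congr rfl fun p _ => ?_
    simp only [Matrix.conjTranspose_apply, clebschGordan, Matrix.of_apply]
    split_ifs with hp
    · rw [Complex.star_def, Complex.conj_ofReal, ← Complex.ofReal_mul,
        Real.mul_self_sqrt (by positivity)]
      push_cast
      rw [hv']
    · simp
  · rw [Matrix.one_apply_ne h]
    refine Finset.sum_eq_zero fun p _ => ?_
    simp only [Matrix.conjTranspose_apply, clebschGordan, Matrix.of_apply]
    split_ifs with h1 h2
    · exact absurd (Fin.ext (h1.symm.trans h2)) h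
    all_goals simp

/-- The Clebsch-Gordan matrix is an isometric intertwiner. -/
lemma clebschGordan_isIsometricIntertwiner (N N₁ N₂ : ℕ) (h : N₁ + N₂ = N) :
    IsIsometricIntertwiner (clebschGordan N N₁ N₂) := by
  subst h
  refine ⟨clebschGordan_isometry N₁ N₂, fun k => ?_⟩
  have h := congrArg Matrix.transpose (clebschGordan_transpose_mul N₁ N₂ k.1ᵀ)
  rw [Matrix.transpose_mul, Matrix.transpose_mul, Matrix.transpose_transpose,
    rep_transpose, Matrix.transpose_transpose, ← Matrix.kroneckerMap_transpose,
    rep_transpose, rep_transpose, Matrix.transpose_transpose] at h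
  exact h

/-! ### Spherical functions and the weight matrix -/

/-- The spherical function `Φ^ℓ_{ℓ₁, ℓ₂} : U → End(H^ℓ)`, `u ↦ β^* ∘ T^{ℓ₁, ℓ₂}(u) ∘ β`, in
the case `ℓ = ℓ₁ + ℓ₂`; here `N = 2ℓ`, `N₁ = 2ℓ₁`, `N₂ = 2ℓ₂`. -/
def sphericalFunction (N N₁ N₂ : ℕ) (u : K × K) : Matrix (Fin (N + 1)) (Fin (N + 1)) ℂ :=
  (clebschGordan N N₁ N₂)ᴴ * repU N₁ N₂ u * clebschGordan N N₁ N₂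

/-- The element `m_t = diag(e^{it/2}, e^{-it/2})` of the maximal torus of `SU(2)`. -/
def torusElt (t : ℝ) : K :=
  ⟨Matrix.diagonal ![Complex.exp (Complex.I * (t / 2)), Complex.exp (-(Complex.I * (t / 2)))], by
    rw [Matrix.mem_specialUnitaryGroup_iff, Matrix.mem_unitaryGroup_iff]
    constructor
    · ext i j
      fin_cases i <;> fin_cases j <;>
        simp [Matrix.star_eq_conjTranspose, Matrix.diagonal_conjTranspose, ← Complex.exp_conj,
          ← Complex.exp_add, Complex.conj_ofNat]
    · simp [← Complex.exp_add]⟩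

/-- The element `a_t = (m_t, m_{-t})` of `A_* ⊂ U`. -/
def aElt (t : ℝ) : K × K := (torusElt t, torusElt (-t))

/-- The full spherical function `Φ^ℓ_0` of degree `0` on `A_*`, `N = 2ℓ`. With rows and columns
labelled by `p = -ℓ + n`, `q = -ℓ + m`, its `(n, m)` entry is
`(Φ^ℓ_{(ℓ + p)/2, (ℓ - p)/2}(a_t))_{q, q}`, and `(ℓ + p)/2 = n/2`, `(ℓ - p)/2 = (N - n)/2`. -/
def fullSphericalZero (N : ℕ) (t : ℝ) : Matrix (Fin (N + 1)) (Fin (N + 1)) ℂ :=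
  Matrix.of fun n m => sphericalFunction N n (N - n) (aElt t) m m

/-- The weight `V^ℓ(a_t) = Φ^ℓ_0(a_t) Φ^ℓ_0(a_t)^* |sin² t|`, `N = 2ℓ`. -/
def weightV (N : ℕ) (t : ℝ) : Matrix (Fin (N + 1)) (Fin (N + 1)) ℂ :=
  ((|Real.sin t ^ 2| : ℝ) : ℂ) • (fullSphericalZero N t * (fullSphericalZero N t)ᴴ)

/-- The weight `W` on `[-1, 1]`, determined by `√(1 - x²) W(x) = V^ℓ(a_{arccos x})` for
`-1 < x < 1` and equal to `0` at `x = ±1`; `N = 2ℓ`. -/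
def weightW (N : ℕ) (x : ℝ) : Matrix (Fin (N + 1)) (Fin (N + 1)) ℂ :=
  (((Real.sqrt (1 - x ^ 2))⁻¹ : ℝ) : ℂ) • weightV N (Real.arccos x)

/-! ### Matrices and blocks -/

/-- `J_m = ∑ i, E_{i, m - 1 - i}`. -/
def matJ (m : ℕ) : Matrix (Fin m) (Fin m) ℂ :=
  Matrix.of fun i j => if j = i.rev then 1 else 0

/-- `F_m = ∑ i, (-1)^i E_{i, i}`. -/
def matF (m : ℕ) : Matrix (Fin m) (Fin m) ℂ :=
  Matrix.diagonal fun i => (-1) ^ (i : ℕ)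

/-- The reflection `X^d` of a matrix in its antidiagonal. -/
def antiTranspose {m : ℕ} (X : Matrix (Fin m) (Fin m) ℂ) : Matrix (Fin m) (Fin m) ℂ :=
  Matrix.of fun i j => X j.rev i.rev

/-- The orthogonal matrix `Y = (1/√2) [[I, J], [-J, I]]` of size `2ℓ + 1 = 2(n + 1)`. -/
def matY (n : ℕ) : Matrix (Fin (n + 1) ⊕ Fin (n + 1)) (Fin (n + 1) ⊕ Fin (n + 1)) ℂ :=
  (((Real.sqrt 2)⁻¹ : ℝ) : ℂ) •
    Matrix.fromBlocks 1 (matJ (n + 1)) (-matJ (n + 1)) 1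

/-- The splitting of the `2ℓ + 1 = 2n + 2` indices into the first `n + 1` and the last `n + 1`. -/
def splitEquiv (n : ℕ) : Fin (n + 1) ⊕ Fin (n + 1) ≃ Fin ((2 * n + 1) + 1) :=
  finSumFinEquiv.trans (finCongr (by omega))

/-- The weight `W(x)` for `ℓ = (2n + 1)/2`, as a `2 × 2` block matrix with blocks of size
`n + 1`. -/
def evenW (n : ℕ) (x : ℝ) :
    Matrix (Fin (n + 1) ⊕ Fin (n + 1)) (Fin (n + 1) ⊕ Fin (n + 1)) ℂ :=
  (weightW (2 * n + 1) x).submatrix (splitEquiv n) (splitEquiv n)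

/-- The upper left block `A(x)` of `W(x)`, `ℓ = (2n + 1)/2`. -/
def blockA (n : ℕ) (x : ℝ) : Matrix (Fin (n + 1)) (Fin (n + 1)) ℂ := (evenW n x).toBlocks₁₁

/-- The upper right block `B(x)` of `W(x)`, `ℓ = (2n + 1)/2`. -/
def blockB (n : ℕ) (x : ℝ) : Matrix (Fin (n + 1)) (Fin (n + 1)) ℂ := (evenW n x).toBlocks₁₂

/-- `W₁(x) = A(x) + B(x) J`. -/
def weightOne (n : ℕ) (x : ℝ) : Matrix (Fin (n + 1)) (Fin (n + 1)) ℂ :=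
  blockA n x + blockB n x * matJ (n + 1)

/-- `W₂(x) = J F W₁(-x) F J`. -/
def weightTwo (n : ℕ) (x : ℝ) : Matrix (Fin (n + 1)) (Fin (n + 1)) ℂ :=
  matJ (n + 1) * matF (n + 1) * weightOne n (-x) * matF (n + 1) * matJ (n + 1)

/-! ### Matrix valued orthogonal polynomials on `(-1, 1)` -/

/-- `W` is a matrix weight on `(-1, 1)`: it is integrable with finite moments of all orders and
positive definite almost everywhere. -/
def IsMatrixWeight {m : ℕ} (W : ℝ → Matrix (Fin m) (Fin m) ℂ) : Prop :=
  (∀ (k : ℕ) (i j : Fin m), MeasureTheory.IntegrableOn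
    (fun x : ℝ => ((x ^ k : ℝ) : ℂ) * W x i j) (Set.Ioo (-1) 1)) ∧
  ∀ᵐ x ∂(MeasureTheory.volume.restrict (Set.Ioo (-1 : ℝ) 1)), (W x).PosDef

/-- The value `P(x)` of a matrix polynomial at a real number. -/
def evalAt {m : ℕ} (P : Polynomial (Matrix (Fin m) (Fin m) ℂ)) (x : ℝ) :
    Matrix (Fin m) (Fin m) ℂ :=
  P.eval (Matrix.scalar (Fin m) (x : ℂ))

/-- The matrix valued form `⟨P, Q⟩ = ∫_{-1}^1 P(x) W(x) Q(x)^* dx`, integrated entrywise. -/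
def matrixInner {m : ℕ} (W : ℝ → Matrix (Fin m) (Fin m) ℂ)
    (P Q : Polynomial (Matrix (Fin m) (Fin m) ℂ)) : Matrix (Fin m) (Fin m) ℂ :=
  Matrix.of fun i j => ∫ x in (-1 : ℝ)..1, (evalAt P x * W x * (evalAt Q x)ᴴ) i j

/-- `(P_d)_{d ≥ 0}` is a sequence of monic orthogonal polynomials with respect to `W`: `P_d` is
monic of degree `d`, and `⟨P_d, P_e⟩ = 0` for `d ≠ e`. -/
def IsMonicMVOP {m : ℕ} (W : ℝ → Matrix (Fin m) (Fin m) ℂ)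
    (P : ℕ → Polynomial (Matrix (Fin m) (Fin m) ℂ)) : Prop :=
  (∀ d, (P d).Monic ∧ (P d).natDegree = d) ∧
  ∀ d e, d ≠ e → matrixInner W (P d) (P e) = 0

/-- The polynomial `(-1)^d J F P(-x) F J`. -/
def reflectPoly {m : ℕ} (d : ℕ) (P : Polynomial (Matrix (Fin m) (Fin m) ℂ)) :
    Polynomial (Matrix (Fin m) (Fin m) ℂ) :=
  (-1) ^ d * (Polynomial.C (matJ m * matF m) * P.comp (-Polynomial.X) *
    Polynomial.C (matF m * matJ m))

/-- The value of `reflectPoly d P` at `x` is `(-1)^d J F P(-x) F J`. -/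
lemma evalAt_reflectPoly {m : ℕ} (d : ℕ) (P : Polynomial (Matrix (Fin m) (Fin m) ℂ)) (x : ℝ) :
    evalAt (reflectPoly d P) x =
      (-1) ^ d * (matJ m * matF m * evalAt P (-x) * matF m * matJ m) := by
  set r := Matrix.scalar (Fin m) (x : ℂ) with hr
  have hc (M : Matrix (Fin m) (Fin m) ℂ) : Commute M r :=
    (Matrix.scalar_commute _ (Commute.all _) _).symm
  let φ : Polynomial (Matrix (Fin m) (Fin m) ℂ) →+* Matrix (Fin m) (Fin m) ℂ :=
    Polynomial.eval₂RingHom' (RingHom.id _) r hc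
  have hφ (Q : Polynomial (Matrix (Fin m) (Fin m) ℂ)) : evalAt Q x = φ Q := rfl
  have hX : φ Polynomial.X = r := by simp [φ]
  have hC (M : Matrix (Fin m) (Fin m) ℂ) : φ (Polynomial.C M) = M := by simp [φ]
  have hcomp : φ (P.comp (-Polynomial.X)) = evalAt P (-x) := by
    rw [Polynomial.comp, Polynomial.eval₂_eq_sum_range, map_sum, evalAt,
      Polynomial.eval_eq_sum_range]
    refine Finset.sum_congr rfl fun i _ => ?_
    rw [map_mul, map_pow, map_neg, hX, hC, hr, Complex.ofReal_neg, map_neg]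
  rw [hφ, reflectPoly, map_mul, map_pow, map_neg, map_one, map_mul, map_mul, hcomp, hC, hC]
  simp only [mul_assoc]

end SU2MVOP

end

noncomputable section

namespace SU2MVOP

/-! Write `u = e^{it/2}`, `v = e^{-it/2}`. The diagonal entries of the spherical functions on `a_t`
are, up to binomial factors, the coefficients of `(vX + uY)^(N-k) (uX + vY)^k`. Hence `Φ_0(a_t) = D
rep(g)ᵀ D` with `g = [[v, u], [u, v]]` and `D` an invertible real diagonal matrix
(`fullSphericalZero_apply`). Since `rep` is multiplicative on all 2 × 2 matrices, identities for `g`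
become identities for `Φ_0`. Exchanging the rows or the columns of `g` conjugates it. Replacing `t`
by `π - t` conjugates it and multiplies by diagonal matrices. Its determinant is `-2i sin t`.

Consequently `W` is real symmetric (`weightW_symm`), invariant under reversing both indices
(`weightW_rev`), multiplied by `(-1)^(k+l)` in entry `(k, l)` under `x ↦ -x` (`weightW_neg`), and
positive definite inside the interval (`posDef_weightW`). Invariance under reversal means that `W`
commutes with the exchange matrix of full size. The columns of `Yᵗ` span its two eigenspaces, so `Y`
splits `W` into `A + BJ` and `J(A - BJ)J`. The parity in `x` turns the second block into the
reflection of the first. Both blocks inherit positivity and continuity.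

For any matrix weight the form is definite (`eq_zero_of_matrixInner_self`), so its Gram map on lower
degree polynomials is bijective, which yields a unique monic orthogonal sequence. The substitution
`x ↦ -x` carries the sequence for `W₁` to one for `W₂`, and uniqueness identifies it. -/

/-! ### The representation extended to all 2 × 2 matrices -/

lemma act_mul (g h : Matrix (Fin 2) (Fin 2) ℂ) (p : MvPolynomial (Fin 2) ℂ) :
    act (g * h) p = act g (act h p) := by
  have : act (g * h) = (act g).comp (act h) := by
    apply MvPolynomial.algHom_ext
    intro i
    have hC (c : ℂ) : act g (MvPolynomial.C c) = MvPolynomial.C c := by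
      simp [act, MvPolynomial.algebraMap_eq]
    have hX (h : Matrix (Fin 2) (Fin 2) ℂ) (i : Fin 2) : act h (MvPolynomial.X i) =
        ∑ j, MvPolynomial.C (h j i) * MvPolynomial.X j := by simp [act]
    simp only [AlgHom.comp_apply, hX, map_mul, hC, Fin.sum_univ_two, Matrix.mul_apply,
      map_add]
    ring
  rw [this]; rfl

/-- Needed for arbitrary matrices, because the matrix `g` that governs `Φ_0` does not lie in
`SU(2)`. -/
lemma rep_mul (N : ℕ) (g h : Matrix (Fin 2) (Fin 2) ℂ) :
    rep N (g * h) = rep N g * rep N h := by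
  ext a b
  rw [rep, Matrix.of_apply, act_mul, act_psi, map_sum, coord_sum, Matrix.mul_apply]
  refine Finset.sum_congr rfl fun c _ => ?_
  have hC (c : ℂ) : act g (MvPolynomial.C c) = MvPolynomial.C c := by
    simp [act, MvPolynomial.algebraMap_eq]
  rw [map_mul, hC, coord_C_mul, mul_comm]
  rfl

lemma rep_diagonal (N : ℕ) (p q : ℂ) :
    rep N (Matrix.diagonal ![p, q]) =
      Matrix.diagonal fun a : Fin (N + 1) => p ^ (N - a : ℕ) * q ^ (a : ℕ) := by
  ext a b
  have h : act (Matrix.diagonal ![p, q]) (psi N b) =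
      MvPolynomial.C (p ^ (N - b : ℕ) * q ^ (b : ℕ)) * psi N b := by
    rw [act_psi_eq, psi]
    simp [mul_pow]
    ring
  rw [rep, Matrix.of_apply, h, coord_C_mul, coord_psi _ _ _ (by omega), Matrix.diagonal_apply]
  by_cases hab : a = b
  · subst hab; simp
  · rw [if_neg hab, if_neg (fun h => hab (Fin.ext h.symm)), mul_zero]

lemma rep_one (N : ℕ) : rep N 1 = 1 := by
  have h := rep_diagonal N 1 1
  simp only [one_pow, mul_one] at h
  rw [Matrix.diagonal_one] at h
  rw [← h]
  congr 1
  ext i j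
  fin_cases i <;> fin_cases j <;> simp

lemma rep_swap (N : ℕ) :
    rep N !![0, 1; 1, 0] = Matrix.of fun a b : Fin (N + 1) => if b = a.rev then 1 else 0 := by
  ext a b
  have h : act !![0, 1; 1, 0] (psi N b) = psi N (N - b) := by
    rw [act_psi_eq, psi, Nat.choose_symm (by omega), Nat.sub_sub_self (by omega)]
    simp
    left
    ring
  rw [rep, Matrix.of_apply, h, coord_psi _ _ _ (by omega), Matrix.of_apply]
  refine if_congr ?_ rfl rfl
  rw [Fin.ext_iff, Fin.val_rev]
  omega

lemma rep_apply (N : ℕ) (g : Matrix (Fin 2) (Fin 2) ℂ) (a b : Fin (N + 1)) :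
    rep N g a b = ((Real.sqrt (N.choose b) : ℝ) : ℂ) / ((Real.sqrt (N.choose a) : ℝ) : ℂ) *
      ∑ s ∈ Finset.range (b + 1), ∑ i ∈ Finset.range (N - b + 1), if i + s = (a : ℕ) then
        ((N - b).choose i : ℂ) * (b : ℕ).choose s *
          (g 0 0 ^ (N - b - i : ℕ) * g 1 0 ^ i * g 0 1 ^ (b - s : ℕ) * g 1 1 ^ s) else 0 := by
  have hN : N - b + b = N := by omega
  rw [← coeff_mul_pow, hN, rep, Matrix.of_apply, act_psi_eq, coord_C_mul, coord]
  ring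

/-- By `rep_apply` the entries are polynomials with real coefficients in the entries of `g`. -/
lemma rep_map_star (N : ℕ) (g : Matrix (Fin 2) (Fin 2) ℂ) (a b : Fin (N + 1)) :
    rep N (g.map star) a b = star (rep N g a b) := by
  rw [rep_apply, rep_apply, star_mul', star_div₀]
  simp only [Complex.star_def, Complex.conj_ofReal, map_sum, Matrix.map_apply]
  congr 1
  refine Finset.sum_congr rfl fun s _ => Finset.sum_congr rfl fun i _ => ?_
  split_ifs <;> simp

/-! ### The spherical function of degree zero and its symmetries -/

/-- The matrix `[[v, u], [u, v]]` with `u = e^{it/2}` and `v = e^{-it/2}`. -/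
def halfAngleMatrix (t : ℝ) : Matrix (Fin 2) (Fin 2) ℂ :=
  !![Complex.exp (-(Complex.I * (t / 2))), Complex.exp (Complex.I * (t / 2));
    Complex.exp (Complex.I * (t / 2)), Complex.exp (-(Complex.I * (t / 2)))]

/-- On `a_t` the tensor product acts diagonally, so a diagonal entry of `Φ` is a sum of squared
Clebsch-Gordan coefficients times powers of `u` and `v`. Term by term this is the binomial expansion
in `rep_apply`, with the summation indices `s`, `i` there equal to the two tensor indices here. -/
lemma fullSphericalZero_apply (N : ℕ) (t : ℝ) (k m : Fin (N + 1)) :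
    fullSphericalZero N t k m = rep N (halfAngleMatrix t) m k /
      (((Real.sqrt (N.choose m) : ℝ) : ℂ) * ((Real.sqrt (N.choose k) : ℝ) : ℂ)) := by
  have hm := sqrt_choose_ne N m (by omega)
  have hk := sqrt_choose_ne N k (by omega)
  set S := ∑ s ∈ Finset.range (k + 1), ∑ i ∈ Finset.range (N - k + 1), if i + s = (m : ℕ) then
        ((N - k).choose i : ℂ) * (k : ℕ).choose s *
          (halfAngleMatrix t 0 0 ^ (N - k - i : ℕ) * halfAngleMatrix t 1 0 ^ i *
            halfAngleMatrix t 0 1 ^ (k - s : ℕ) * halfAngleMatrix t 1 1 ^ s) else 0 with hS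
  have h1 : rep N (halfAngleMatrix t) m k /
      (((Real.sqrt (N.choose m) : ℝ) : ℂ) * ((Real.sqrt (N.choose k) : ℝ) : ℂ)) =
      S / (N.choose m : ℂ) := by
    rw [rep_apply, ← hS, ← sqrt_choose_sq]
    field_simp
  rw [h1]
  have h2 : repU k (N - k) (aElt t) = Matrix.diagonal fun p =>
      (Complex.exp (Complex.I * (t / 2)) ^ (k - p.1 : ℕ) *
        Complex.exp (-(Complex.I * (t / 2))) ^ (p.1 : ℕ)) *
      (Complex.exp (-(Complex.I * (t / 2))) ^ (N - k - p.2 : ℕ) *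
        Complex.exp (Complex.I * (t / 2)) ^ (p.2 : ℕ)) := by
    have e : (torusElt (-t)).1 = Matrix.diagonal ![Complex.exp (-(Complex.I * (t / 2))),
        Complex.exp (Complex.I * (t / 2))] := by
      simp only [torusElt, Complex.ofReal_neg, neg_div, mul_neg, neg_neg]
    have e' : (torusElt t).1 = Matrix.diagonal ![Complex.exp (Complex.I * (t / 2)),
        Complex.exp (-(Complex.I * (t / 2)))] := rfl
    rw [repU, aElt, e, e', rep_diagonal, rep_diagonal, Matrix.diagonal_kronecker_diagonal]
  rw [fullSphericalZero, Matrix.of_apply, sphericalFunction, h2, Matrix.mul_apply]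
  simp only [Matrix.mul_diagonal, Matrix.conjTranspose_apply]
  rw [Fintype.sum_prod_type, hS, Finset.sum_div, Finset.sum_range]
  refine Finset.sum_congr rfl fun a _ => ?_
  rw [Finset.sum_div, Finset.sum_range]
  refine Finset.sum_congr rfl fun b _ => ?_
  simp only [clebschGordan, Matrix.of_apply]
  by_cases h : (a : ℕ) + (b : ℕ) = m
  · rw [if_pos h, if_pos (by omega)]
    have hs : ((Real.sqrt (((k : ℕ).choose a * (N - k).choose b : ℝ) / N.choose m) : ℝ) : ℂ) *
        ((Real.sqrt (((k : ℕ).choose a * (N - k).choose b : ℝ) / N.choose m) : ℝ) : ℂ) =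
        ((k : ℕ).choose a * (N - k).choose b : ℂ) / N.choose m := by
      rw [← Complex.ofReal_mul, Real.mul_self_sqrt (by positivity)]
      push_cast
      rfl
    rw [Complex.star_def, Complex.conj_ofReal]
    simp only [halfAngleMatrix, Matrix.of_apply, Matrix.cons_val', Matrix.cons_val_zero,
      Matrix.cons_val_one, Matrix.cons_val_fin_one]
    rw [mul_right_comm, hs]
    ring
  · rw [if_neg h, if_neg (by omega)]
    simp

lemma halfAngleMatrix_map_star (t : ℝ) : (halfAngleMatrix t).map star =
    !![Complex.exp (Complex.I * (t / 2)), Complex.exp (-(Complex.I * (t / 2)));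
      Complex.exp (-(Complex.I * (t / 2))), Complex.exp (Complex.I * (t / 2))] := by
  ext i j
  fin_cases i <;> fin_cases j <;> simp [halfAngleMatrix, ← Complex.exp_conj, Complex.conj_ofNat]

/-- Conjugation exchanges `u` and `v`, that is, the columns of the half angle matrix, and `rep`
sends the exchange to index reversal. In `fullSphericalZero_rev_right` the rows are exchanged
instead. -/
lemma fullSphericalZero_rev_left (N : ℕ) (t : ℝ) (k m : Fin (N + 1)) :
    fullSphericalZero N t k.rev m = star (fullSphericalZero N t k m) := by
  have h : (halfAngleMatrix t).map star = halfAngleMatrix t * !![0, 1; 1, 0] := by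
    rw [halfAngleMatrix_map_star, halfAngleMatrix, Matrix.mul_fin_two]
    simp
  have h2 : star (rep N (halfAngleMatrix t) m k) = rep N (halfAngleMatrix t) m k.rev := by
    rw [← rep_map_star, h, rep_mul, rep_swap, Matrix.mul_apply,
      Finset.sum_eq_single k.rev]
    · simp
    · intro b _ hb
      rw [Matrix.of_apply, if_neg (fun h => hb (by rw [h, Fin.rev_rev])), mul_zero]
    · simp
  rw [fullSphericalZero_apply, fullSphericalZero_apply, star_div₀, h2, star_mul']
  simp only [Complex.star_def, Complex.conj_ofReal, Fin.val_rev]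
  rw [show N + 1 - (k + 1) = N - k by omega, Nat.choose_symm (by omega)]

lemma fullSphericalZero_rev_right (N : ℕ) (t : ℝ) (k m : Fin (N + 1)) :
    fullSphericalZero N t k m.rev = star (fullSphericalZero N t k m) := by
  have h : (halfAngleMatrix t).map star = !![0, 1; 1, 0] * halfAngleMatrix t := by
    rw [halfAngleMatrix_map_star, halfAngleMatrix, Matrix.mul_fin_two]
    simp
  have h2 : star (rep N (halfAngleMatrix t) m k) = rep N (halfAngleMatrix t) m.rev k := by
    rw [← rep_map_star, h, rep_mul, rep_swap, Matrix.mul_apply,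
      Finset.sum_eq_single m.rev] <;> simp +contextual
  rw [fullSphericalZero_apply, fullSphericalZero_apply, star_div₀, h2, star_mul']
  simp only [Complex.star_def, Complex.conj_ofReal, Fin.val_rev]
  rw [show N + 1 - (m + 1) = N - m by omega, Nat.choose_symm (by omega)]

/-- The substitution turns `u` into `i v` and `v` into `-i u`. These factors come out as diagonal
matrices on either side of the conjugated half angle matrix. -/
lemma fullSphericalZero_pi_sub (N : ℕ) (t : ℝ) (k m : Fin (N + 1)) :
    fullSphericalZero N (Real.pi - t) k m = (-1) ^ (m : ℕ) *
      ((-Complex.I) ^ (N - k : ℕ) * Complex.I ^ (k : ℕ)) * star (fullSphericalZero N t k m) := by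
  have e : Complex.exp (Complex.I * ((Real.pi - t : ℝ) / 2)) =
      Complex.I * Complex.exp (-(Complex.I * (t / 2))) := by
    rw [show Complex.I * ((Real.pi - t : ℝ) / 2) =
      Real.pi / 2 * Complex.I + -(Complex.I * (t / 2)) by push_cast; ring, Complex.exp_add,
      Complex.exp_pi_div_two_mul_I]
  have e' : Complex.exp (-(Complex.I * ((Real.pi - t : ℝ) / 2))) =
      -Complex.I * Complex.exp (Complex.I * (t / 2)) := by
    rw [show -(Complex.I * ((Real.pi - t : ℝ) / 2)) =
      -Real.pi / 2 * Complex.I + Complex.I * (t / 2) by push_cast; ring, Complex.exp_add,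
      Complex.exp_neg_pi_div_two_mul_I]
  have h : halfAngleMatrix (Real.pi - t) = Matrix.diagonal ![1, -1] *
      (halfAngleMatrix t).map star * Matrix.diagonal ![-Complex.I, Complex.I] := by
    rw [halfAngleMatrix_map_star, halfAngleMatrix, e, e']
    ext i j
    fin_cases i <;> fin_cases j <;>
      simp [Matrix.diagonal_mul, Matrix.mul_diagonal, mul_comm]
  rw [fullSphericalZero_apply, fullSphericalZero_apply, h, rep_mul, rep_mul, rep_diagonal,
    rep_diagonal, Matrix.mul_diagonal, Matrix.diagonal_mul, rep_map_star, star_div₀, star_mul']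
  simp only [Complex.star_def, Complex.conj_ofReal, one_pow, one_mul]
  ring

/-- An invertible `g` has an invertible `rep N g`, by multiplicativity, and `Φ_0` differs from its
transpose only by invertible diagonal factors. -/
lemma isUnit_fullSphericalZero (N : ℕ) (t : ℝ) (ht : Real.sin t ≠ 0) :
    IsUnit (fullSphericalZero N t) := by
  have hdet : (halfAngleMatrix t).det = -(2 * Complex.I * Real.sin t) := by
    rw [halfAngleMatrix, Matrix.det_fin_two_of, ← Complex.exp_add, ← Complex.exp_add,
      Complex.ofReal_sin, Complex.sin]
    ring_nf
    rw [Complex.I_sq]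
    ring_nf
  have hg : IsUnit (halfAngleMatrix t).det := by
    rw [hdet]
    simp [Complex.I_ne_zero, -Complex.ofReal_sin, ht]
  have hR : IsUnit (rep N (halfAngleMatrix t)) := by
    refine (Matrix.isUnit_iff_isUnit_det _).2 (Matrix.isUnit_det_of_right_inverse
      (B := rep N (halfAngleMatrix t)⁻¹) ?_)
    rw [← rep_mul, Matrix.mul_nonsing_inv _ hg, rep_one]
  have hD : IsUnit (Matrix.diagonal fun a : Fin (N + 1) =>
      ((Real.sqrt (N.choose a) : ℝ) : ℂ)⁻¹) := by
    rw [Matrix.isUnit_iff_isUnit_det, Matrix.det_diagonal, isUnit_iff_ne_zero,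
      Finset.prod_ne_zero_iff]
    exact fun a _ => inv_ne_zero (sqrt_choose_ne N a (by omega))
  have e : fullSphericalZero N t = Matrix.diagonal (fun a : Fin (N + 1) =>
      ((Real.sqrt (N.choose a) : ℝ) : ℂ)⁻¹) * (rep N (halfAngleMatrix t))ᵀ *
      Matrix.diagonal (fun a : Fin (N + 1) => ((Real.sqrt (N.choose a) : ℝ) : ℂ)⁻¹) := by
    ext k m
    rw [Matrix.mul_diagonal, Matrix.diagonal_mul, fullSphericalZero_apply,
      Matrix.transpose_apply, div_eq_mul_inv, mul_inv]
    ring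
  rw [e]
  refine (hD.mul ?_).mul hD
  rw [Matrix.isUnit_iff_isUnit_det, Matrix.det_transpose]
  exact (Matrix.isUnit_iff_isUnit_det _).1 hR

lemma continuous_fullSphericalZero (N : ℕ) (k m : Fin (N + 1)) :
    Continuous fun t => fullSphericalZero N t k m := by
  simp only [fullSphericalZero_apply, rep_apply, halfAngleMatrix, Matrix.of_apply,
    Matrix.cons_val', Matrix.cons_val_zero, Matrix.cons_val_one, Matrix.cons_val_fin_one]
  refine (continuous_const.mul ?_).div_const _
  refine continuous_finsetSum _ fun s _ => continuous_finsetSum _ fun i _ => ?_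
  split_ifs <;> fun_prop

/-! ### Symmetry, parity, positivity and continuity of `W` -/

/-- Valid for every real `x`: `a⁻¹ * a * a = a` also holds at `a = 0`, so the endpoints need no
separate treatment. No negative power of `1 - x ^ 2` remains, which gives continuity on the closed
interval. -/
lemma weightW_eq (N : ℕ) (x : ℝ) :
    weightW N x = ((Real.sqrt (1 - x ^ 2) : ℝ) : ℂ) • (fullSphericalZero N (Real.arccos x) *
      (fullSphericalZero N (Real.arccos x))ᴴ) := by
  rw [weightW, weightV, smul_smul, ← Complex.ofReal_mul, Real.sin_arccos, abs_sq, sq (Real.sqrt _),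
    ← mul_assoc, inv_mul_mul_self]

lemma weightW_apply (N : ℕ) (x : ℝ) (k l : Fin (N + 1)) :
    weightW N x k l = (((Real.sqrt (1 - x ^ 2))⁻¹ * |Real.sin (Real.arccos x) ^ 2| : ℝ) : ℂ) *
      ∑ m, fullSphericalZero N (Real.arccos x) k m *
        star (fullSphericalZero N (Real.arccos x) l m) := by
  rw [weightW, weightV, smul_smul, ← Complex.ofReal_mul, Matrix.smul_apply, Matrix.mul_apply,
    smul_eq_mul]
  rfl

lemma weightW_swap (N : ℕ) (x : ℝ) (k l : Fin (N + 1)) :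
    weightW N x l k = star (weightW N x k l) := by
  rw [weightW_apply, weightW_apply, star_mul', star_sum, Complex.star_def, Complex.conj_ofReal]
  congr 1
  refine Finset.sum_congr rfl fun m _ => ?_
  rw [← Complex.star_def, star_mul', star_star, mul_comm]

/-- Reversing the summation index `m` conjugates every factor, so the entries of `W` are real. -/
lemma weightW_star (N : ℕ) (x : ℝ) (k l : Fin (N + 1)) :
    star (weightW N x k l) = weightW N x k l := by
  rw [weightW_apply, star_mul', star_sum, Complex.star_def, Complex.conj_ofReal]
  congr 1
  refine Fintype.sum_equiv Fin.revPerm _ _ fun m => ?_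
  rw [Fin.revPerm_apply, fullSphericalZero_rev_right, fullSphericalZero_rev_right,
    ← Complex.star_def, star_mul']

lemma weightW_rev (N : ℕ) (x : ℝ) (k l : Fin (N + 1)) :
    weightW N x k.rev l.rev = weightW N x k l := by
  rw [← weightW_star N x k l, weightW_apply, weightW_apply, star_mul', star_sum,
    Complex.star_def, Complex.conj_ofReal]
  simp only [← Complex.star_def, fullSphericalZero_rev_left, star_mul']

lemma weightW_symm (N : ℕ) (x : ℝ) (k l : Fin (N + 1)) : weightW N x l k = weightW N x k l := by
  rw [weightW_swap, weightW_star]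

/-- Each factor is `(-1)^j (-i)^N`, and the unimodular `(-i)^N` cancels against its conjugate. -/
lemma neg_I_pow_mul_I_pow_mul_star (N k l : ℕ) (hk : k ≤ N) (hl : l ≤ N) :
    ((-Complex.I) ^ (N - k) * Complex.I ^ k) * star ((-Complex.I) ^ (N - l) * Complex.I ^ l) =
      (-1) ^ (k + l) := by
  have h (j : ℕ) (hj : j ≤ N) : (-Complex.I) ^ (N - j) * Complex.I ^ j =
      (-1) ^ j * (-Complex.I) ^ N := by
    obtain ⟨i, rfl⟩ := Nat.exists_eq_add_of_le hj
    rw [Nat.add_sub_cancel_left, pow_add, ← mul_assoc, ← mul_pow, mul_comm]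
    simp
  rw [h k hk, h l hl]
  simp only [star_mul', star_pow, star_neg, star_one, Complex.star_def, Complex.conj_I, neg_neg]
  calc _ = (-1) ^ (k + l) * (-Complex.I * Complex.I) ^ N := by rw [mul_pow, pow_add]; ring
    _ = _ := by simp

/-- Since `arccos (-x) = π - arccos x`, `fullSphericalZero_pi_sub` applies. Its sign `(-1)^m` occurs
twice and cancels; the remaining conjugation is harmless because `W` is real. -/
lemma weightW_neg (N : ℕ) (x : ℝ) (k l : Fin (N + 1)) :
    weightW N (-x) k l = (-1) ^ (k + l : ℕ) * weightW N x k l := by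
  rw [← weightW_star N x k l, ← neg_I_pow_mul_I_pow_mul_star N k l (by omega) (by omega),
    weightW_apply, weightW_apply, star_mul' (Complex.ofReal _), star_sum,
    show star (Complex.ofReal _) = _ from Complex.conj_ofReal _, Real.arccos_neg, Real.sin_pi_sub, neg_sq, mul_left_comm, Finset.mul_sum _ _ (_ * _)]
  congr 1
  refine Finset.sum_congr rfl fun m _ => ?_
  have h : ((-1 : ℂ) ^ (m : ℕ)) * (-1) ^ (m : ℕ) = 1 := by rw [← mul_pow]; simp
  have h' : star ((-1 : ℂ) ^ (m : ℕ)) = (-1) ^ (m : ℕ) := by simp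
  have e (a b c : ℂ) : star (a * b * star c) = star a * star b * c := by
    rw [star_mul', star_mul', star_star]
  have e' (a b : ℂ) : star (a * star b) = star a * b := by rw [star_mul', star_star]
  rw [fullSphericalZero_pi_sub, fullSphericalZero_pi_sub, e, e', h']
  linear_combination ((-Complex.I) ^ (N - k : ℕ) * Complex.I ^ (k : ℕ)) *
    star ((-Complex.I) ^ (N - l : ℕ) * Complex.I ^ (l : ℕ)) *
    (star (fullSphericalZero N (Real.arccos x) k m) *
      fullSphericalZero N (Real.arccos x) l m) * h

lemma posDef_weightW (N : ℕ) (x : ℝ) (hx : x ∈ Set.Ioo (-1 : ℝ) 1) : (weightW N x).PosDef := by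
  have h : (0 : ℝ) < 1 - x ^ 2 := by nlinarith [hx.1, hx.2]
  have hs : Real.sin (Real.arccos x) ≠ 0 := by
    rw [Real.sin_arccos]
    exact (Real.sqrt_pos.2 h).ne'
  rw [weightW_eq N x]
  refine Matrix.PosDef.smul (Matrix.PosDef.mul_conjTranspose_self _ ?_) ?_
  · exact Matrix.vecMul_injective_of_isUnit (isUnit_fullSphericalZero N _ hs)
  · exact_mod_cast Real.sqrt_pos.2 h

lemma continuousOn_weightW (N : ℕ) (k l : Fin (N + 1)) :
    ContinuousOn (fun x => weightW N x k l) (Set.Icc (-1) 1) := by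
  refine ContinuousOn.congr (f := fun x : ℝ => ((Real.sqrt (1 - x ^ 2) : ℝ) : ℂ) •
    (fullSphericalZero N (Real.arccos x) * (fullSphericalZero N (Real.arccos x))ᴴ) k l) ?_
    fun x _ => by rw [weightW_eq N x, Matrix.smul_apply]
  apply Continuous.continuousOn
  simp only [Matrix.mul_apply, Matrix.conjTranspose_apply]
  have h (k m : Fin (N + 1)) : Continuous fun x => fullSphericalZero N (Real.arccos x) k m :=
    (continuous_fullSphericalZero N k m).comp Real.continuous_arccos
  fun_prop

/-! ### Blocks of `W` and conjugation by `Y` -/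

lemma val_splitEquiv_inl (n : ℕ) (i : Fin (n + 1)) : (splitEquiv n (Sum.inl i) : ℕ) = i := by
  simp [splitEquiv]

lemma val_splitEquiv_inr (n : ℕ) (i : Fin (n + 1)) :
    (splitEquiv n (Sum.inr i) : ℕ) = n + 1 + i := by
  simp [splitEquiv, add_comm]

lemma splitEquiv_inr (n : ℕ) (i : Fin (n + 1)) :
    splitEquiv n (Sum.inr i) = (splitEquiv n (Sum.inl i.rev)).rev := by
  ext
  rw [Fin.val_rev, val_splitEquiv_inl, val_splitEquiv_inr, Fin.val_rev]
  omega

lemma matJ_mul_apply {m : ℕ} (X : Matrix (Fin m) (Fin m) ℂ) (i j : Fin m) :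
    (matJ m * X) i j = X i.rev j := by
  simp [Matrix.mul_apply, matJ]

lemma mul_matJ_apply {m : ℕ} (X : Matrix (Fin m) (Fin m) ℂ) (i j : Fin m) :
    (X * matJ m) i j = X i j.rev := by
  rw [Matrix.mul_apply, Finset.sum_eq_single j.rev]
  · simp [matJ]
  · intro b _ hb
    rw [matJ, Matrix.of_apply, if_neg (fun h => hb (by rw [h, Fin.rev_rev])), mul_zero]
  · simp

lemma matJ_mul_matJ (m : ℕ) : matJ m * matJ m = 1 := by
  ext i j
  rw [matJ_mul_apply, matJ, Matrix.of_apply, Fin.rev_rev, Matrix.one_apply]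
  simp [eq_comm]

lemma matF_mul_matF (m : ℕ) : matF m * matF m = 1 := by
  rw [matF, Matrix.diagonal_mul_diagonal, ← Matrix.diagonal_one]
  congr 1
  ext i
  rw [← mul_pow]
  simp

lemma matJ_transpose (m : ℕ) : (matJ m)ᵀ = matJ m := by
  ext i j
  simp only [matJ, Matrix.transpose_apply, Matrix.of_apply]
  exact if_congr (by rw [← Fin.rev_eq_iff, eq_comm]) rfl rfl

lemma matJ_conjTranspose (m : ℕ) : (matJ m)ᴴ = matJ m := by
  rw [← matJ_transpose, Matrix.conjTranspose, Matrix.transpose_transpose, matJ_transpose]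
  ext i j
  simp only [matJ, Matrix.map_apply, Matrix.of_apply]
  split_ifs <;> simp

lemma matF_conjTranspose (m : ℕ) : (matF m)ᴴ = matF m := by
  rw [matF, Matrix.diagonal_conjTranspose]
  congr 1
  ext i
  simp

lemma antiTranspose_transpose {m : ℕ} (X : Matrix (Fin m) (Fin m) ℂ) :
    (antiTranspose X)ᵀ = matJ m * X * matJ m := by
  ext i j
  rw [mul_matJ_apply, matJ_mul_apply]
  rfl

lemma blockA_transpose (n : ℕ) (x : ℝ) : (blockA n x)ᵀ = blockA n x := by
  ext i j
  exact weightW_symm _ _ _ _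

/-- The reversal of all indices exchanges the two halves, so the lower blocks are `JBJ` and `JAJ` by
`weightW_rev`. -/
lemma evenW_eq_fromBlocks (n : ℕ) (x : ℝ) :
    evenW n x = Matrix.fromBlocks (blockA n x) (blockB n x)
      (antiTranspose (blockB n x))ᵀ (antiTranspose (blockA n x))ᵀ := by
  conv_lhs => rw [← Matrix.fromBlocks_toBlocks (evenW n x)]
  congr 1
  · ext i j
    change weightW _ x _ _ = weightW _ x _ _
    rw [splitEquiv_inr, splitEquiv_inr, ← weightW_rev, Fin.rev_rev, Fin.rev_rev]
  · ext i j
    change weightW _ x _ _ = weightW _ x _ _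
    rw [splitEquiv_inr, splitEquiv_inr, weightW_rev]

lemma matF_mul_weightOne_neg_mul_matF (n : ℕ) (x : ℝ) :
    matF (n + 1) * weightOne n (-x) * matF (n + 1) =
      blockA n x - blockB n x * matJ (n + 1) := by
  ext i j
  have h : ((-1 : ℂ) ^ (i : ℕ)) * (-1) ^ (i : ℕ) = 1 := by rw [← mul_pow]; simp
  have h' : ((-1 : ℂ) ^ (j : ℕ)) * (-1) ^ (j : ℕ) = 1 := by rw [← mul_pow]; simp
  have hA : blockA n (-x) i j = (-1) ^ (i + j : ℕ) * blockA n x i j := by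
    have := weightW_neg (2 * n + 1) x (splitEquiv n (Sum.inl i)) (splitEquiv n (Sum.inl j))
    rwa [val_splitEquiv_inl, val_splitEquiv_inl] at this
  -- Column `j.rev` of `B` is column `n + 1 + (n - j)` of `W`, whose parity is opposite to that of
  -- `j`. This extra sign produces the minus in `A - BJ`.
  have hB : blockB n (-x) i j.rev = (-1) ^ (i + j + 1 : ℕ) * blockB n x i j.rev := by
    have := weightW_neg (2 * n + 1) x (splitEquiv n (Sum.inl i)) (splitEquiv n (Sum.inr j.rev))
    rw [val_splitEquiv_inl, val_splitEquiv_inr, Fin.val_rev] at this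
    have e : (-1 : ℂ) ^ (i + (n + 1 + (n + 1 - (j + 1))) : ℕ) = (-1) ^ (i + j + 1 : ℕ) := by
      rw [neg_one_pow_eq_pow_mod_two, neg_one_pow_eq_pow_mod_two (n := i + j + 1)]
      congr 1
      omega
    rwa [e] at this
  rw [matF, Matrix.mul_diagonal, Matrix.diagonal_mul, weightOne, Matrix.add_apply,
    Matrix.sub_apply, mul_matJ_apply, mul_matJ_apply, hA, hB, pow_succ, pow_add]
  linear_combination (blockA n x i j - blockB n x i j.rev) *
    ((-1 : ℂ) ^ (j : ℕ) * (-1) ^ (j : ℕ) * h + h')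

lemma weightTwo_eq (n : ℕ) (x : ℝ) : weightTwo n x =
    matJ (n + 1) * (blockA n x - blockB n x * matJ (n + 1)) * matJ (n + 1) := by
  rw [weightTwo, ← matF_mul_weightOne_neg_mul_matF]
  simp only [Matrix.mul_assoc]

lemma inv_sqrt_two_mul_self :
    (((Real.sqrt 2)⁻¹ : ℝ) : ℂ) * (((Real.sqrt 2)⁻¹ : ℝ) : ℂ) = 2⁻¹ := by
  rw [← Complex.ofReal_mul, ← mul_inv, Real.mul_self_sqrt (by norm_num)]
  simp

lemma matY_transpose (n : ℕ) : (matY n)ᵀ = (((Real.sqrt 2)⁻¹ : ℝ) : ℂ) •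
    Matrix.fromBlocks 1 (-matJ (n + 1)) (matJ (n + 1)) 1 := by
  rw [matY, Matrix.transpose_smul, Matrix.fromBlocks_transpose, Matrix.transpose_neg,
    matJ_transpose, Matrix.transpose_one]

lemma matY_conjTranspose (n : ℕ) : (matY n)ᴴ = (matY n)ᵀ := by
  rw [matY_transpose, matY, Matrix.conjTranspose_smul, Matrix.fromBlocks_conjTranspose,
    Matrix.conjTranspose_neg, matJ_conjTranspose, Matrix.conjTranspose_one, Complex.star_def,
    Complex.conj_ofReal]

lemma matY_mul_transpose (n : ℕ) : matY n * (matY n)ᵀ = 1 := by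
  rw [matY_transpose, matY, Matrix.smul_mul, Matrix.mul_smul, smul_smul, inv_sqrt_two_mul_self,
    Matrix.fromBlocks_multiply, ← Matrix.fromBlocks_one, Matrix.fromBlocks_smul]
  simp only [Matrix.one_mul, Matrix.mul_one, Matrix.mul_neg, Matrix.neg_mul, neg_neg,
    matJ_mul_matJ, neg_add_cancel, smul_zero, ← two_smul ℂ (1 : Matrix (Fin (n + 1)) _ ℂ),
    smul_smul]
  norm_num

/-- With lower blocks `JBJ` and `JAJ` and `J² = 1`, the off-diagonal products cancel, and the
diagonal ones come out doubled, which the factor `1/2` from the two scalars of `Y` absorbs. -/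
lemma matY_mul_evenW_mul_transpose (n : ℕ) (x : ℝ) :
    matY n * evenW n x * (matY n)ᵀ = Matrix.fromBlocks (weightOne n x) 0 0 (weightTwo n x) := by
  have hJ (X : Matrix (Fin (n + 1)) (Fin (n + 1)) ℂ) : matJ (n + 1) * (matJ (n + 1) * X) = X := by
    rw [← Matrix.mul_assoc, matJ_mul_matJ, Matrix.one_mul]
  rw [matY_transpose, matY, evenW_eq_fromBlocks, Matrix.smul_mul, Matrix.smul_mul,
    Matrix.mul_smul, smul_smul, inv_sqrt_two_mul_self, Matrix.fromBlocks_multiply,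
    Matrix.fromBlocks_multiply, Matrix.fromBlocks_smul, antiTranspose_transpose,
    antiTranspose_transpose, weightTwo_eq, weightOne]
  congr 1
  · simp only [Matrix.one_mul, Matrix.mul_one, Matrix.add_mul, Matrix.mul_assoc, hJ,
      matJ_mul_matJ]
    module
  · simp only [Matrix.one_mul, Matrix.mul_one, Matrix.add_mul, Matrix.mul_assoc, hJ,
      matJ_mul_matJ, Matrix.mul_neg]
    module
  · simp only [Matrix.one_mul, Matrix.mul_one, Matrix.add_mul, Matrix.mul_assoc,
      matJ_mul_matJ, Matrix.neg_mul]
    module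
  · simp only [Matrix.one_mul, Matrix.mul_one, Matrix.add_mul, Matrix.mul_assoc,
      matJ_mul_matJ, Matrix.neg_mul, Matrix.mul_neg, Matrix.mul_sub, Matrix.sub_mul]
    module

/-- `Y` is real orthogonal, so this is a congruence of the positive definite `W`; its principal
submatrices are then positive definite too. -/
lemma posDef_fromBlocks_weights (n : ℕ) (x : ℝ) (hx : x ∈ Set.Ioo (-1 : ℝ) 1) :
    (Matrix.fromBlocks (weightOne n x) 0 0 (weightTwo n x)).PosDef := by
  rw [← matY_mul_evenW_mul_transpose, ← matY_conjTranspose]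
  refine Matrix.PosDef.mul_mul_conjTranspose_same
    ((posDef_weightW _ x hx).submatrix (splitEquiv n).injective) ?_
  exact Matrix.vecMul_injective_of_isUnit ((Matrix.isUnit_iff_isUnit_det _).2
    (Matrix.isUnit_det_of_right_inverse (matY_mul_transpose n)))

lemma posDef_weightOne (n : ℕ) (x : ℝ) (hx : x ∈ Set.Ioo (-1 : ℝ) 1) :
    (weightOne n x).PosDef :=
  (posDef_fromBlocks_weights n x hx).submatrix Sum.inl_injective

lemma posDef_weightTwo (n : ℕ) (x : ℝ) (hx : x ∈ Set.Ioo (-1 : ℝ) 1) :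
    (weightTwo n x).PosDef :=
  (posDef_fromBlocks_weights n x hx).submatrix Sum.inr_injective

lemma continuousOn_weightOne (n : ℕ) (i j : Fin (n + 1)) :
    ContinuousOn (fun x => weightOne n x i j) (Set.Icc (-1) 1) := by
  simp only [weightOne, Matrix.add_apply, mul_matJ_apply]
  exact (continuousOn_weightW _ _ _).add (continuousOn_weightW _ _ _)

lemma continuousOn_weightTwo (n : ℕ) (i j : Fin (n + 1)) :
    ContinuousOn (fun x => weightTwo n x i j) (Set.Icc (-1) 1) := by
  simp only [weightTwo_eq, mul_matJ_apply, matJ_mul_apply, Matrix.sub_apply]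
  exact (continuousOn_weightW _ _ _).sub (continuousOn_weightW _ _ _)

/-! ### Matrix weights and their matrix valued forms -/

lemma isMatrixWeight_of_continuousOn {m : ℕ} {W : ℝ → Matrix (Fin m) (Fin m) ℂ}
    (hc : ∀ i j, ContinuousOn (fun x => W x i j) (Set.Icc (-1) 1))
    (hp : ∀ x ∈ Set.Ioo (-1 : ℝ) 1, (W x).PosDef) : IsMatrixWeight W := by
  refine ⟨fun k i j => ?_, ?_⟩
  · refine (ContinuousOn.integrableOn_compact isCompact_Icc ?_).mono_set Set.Ioo_subset_Icc_self
    refine ContinuousOn.mul ?_ (hc i j)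
    fun_prop
  · exact (MeasureTheory.ae_restrict_iff' measurableSet_Ioo).2 (Filter.Eventually.of_forall hp)

lemma isMatrixWeight_weightOne (n : ℕ) : IsMatrixWeight (weightOne n) :=
  isMatrixWeight_of_continuousOn (continuousOn_weightOne n) (posDef_weightOne n)

lemma isMatrixWeight_weightTwo (n : ℕ) : IsMatrixWeight (weightTwo n) :=
  isMatrixWeight_of_continuousOn (continuousOn_weightTwo n) (posDef_weightTwo n)

/-- Over noncommuting coefficients evaluation is multiplicative because the point is a scalar
matrix, which commutes with every coefficient. -/
lemma evalAt_eq_eval₂RingHom' {m : ℕ} (P : Polynomial (Matrix (Fin m) (Fin m) ℂ)) (x : ℝ) :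
    evalAt P x = Polynomial.eval₂RingHom' (RingHom.id _) (Matrix.scalar (Fin m) (x : ℂ))
      (fun M => (Matrix.scalar_commute _ (Commute.all _) M).symm) P := rfl

lemma evalAt_add {m : ℕ} (P Q : Polynomial (Matrix (Fin m) (Fin m) ℂ)) (x : ℝ) :
    evalAt (P + Q) x = evalAt P x + evalAt Q x := by
  simp only [evalAt_eq_eval₂RingHom', map_add]

lemma evalAt_C_mul {m : ℕ} (A : Matrix (Fin m) (Fin m) ℂ)
    (P : Polynomial (Matrix (Fin m) (Fin m) ℂ)) (x : ℝ) :
    evalAt (Polynomial.C A * P) x = A * evalAt P x := by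
  rw [evalAt_eq_eval₂RingHom', map_mul, ← evalAt_eq_eval₂RingHom']
  congr 1
  exact Polynomial.eval₂_C _ _

/-- Reduces to ordinary complex polynomials, from which continuity and the finiteness of the zero
set are taken. -/
lemma evalAt_apply {m : ℕ} (P : Polynomial (Matrix (Fin m) (Fin m) ℂ)) (x : ℝ) (i j : Fin m) :
    evalAt P x i j = (matPolyEquiv.symm P i j).eval (x : ℂ) := by
  rw [← matPolyEquiv_eval, AlgEquiv.apply_symm_apply, evalAt]

lemma continuous_evalAt_apply {m : ℕ} (P : Polynomial (Matrix (Fin m) (Fin m) ℂ))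
    (i j : Fin m) : Continuous fun x => evalAt P x i j := by
  simp only [evalAt_apply]
  exact (Polynomial.continuous _).comp Complex.continuous_ofReal

section Inner

variable {m : ℕ} {W : ℝ → Matrix (Fin m) (Fin m) ℂ}

lemma IsMatrixWeight.intervalIntegrable (hW : IsMatrixWeight W)
    (P Q : Polynomial (Matrix (Fin m) (Fin m) ℂ)) (i j : Fin m) :
    IntervalIntegrable (fun x => (evalAt P x * W x * (evalAt Q x)ᴴ) i j) MeasureTheory.volume
      (-1) 1 := by
  rw [intervalIntegrable_iff_integrableOn_Icc_of_le (by norm_num)]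
  have h (k l : Fin m) : MeasureTheory.IntegrableOn
      (fun x => evalAt P x i k * W x k l * star (evalAt Q x j l)) (Set.Icc (-1 : ℝ) 1) := by
    have h0 : MeasureTheory.IntegrableOn (fun x => W x k l) (Set.Icc (-1 : ℝ) 1) := by
      rw [integrableOn_Icc_iff_integrableOn_Ioo]
      -- The zeroth moment suffices, since polynomial factors are continuous on the compact
      -- interval.
      simpa using hW.1 0 k l
    refine ((h0.continuousOn_mul (continuous_evalAt_apply P i k).continuousOn
      isCompact_Icc).mul_continuousOn ?_ isCompact_Icc)
    exact (continuous_evalAt_apply Q j l).star.continuousOn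
  simp only [Matrix.mul_apply, Matrix.conjTranspose_apply, Finset.sum_mul]
  exact MeasureTheory.integrable_finsetSum _ fun l _ =>
    MeasureTheory.integrable_finsetSum _ fun k _ => h k l

lemma integral_mul_mul_apply {G : ℝ → Matrix (Fin m) (Fin m) ℂ}
    (hG : ∀ i j, IntervalIntegrable (fun x => G x i j) MeasureTheory.volume (-1) 1)
    (A B : Matrix (Fin m) (Fin m) ℂ) (i j : Fin m) :
    ∫ x in (-1 : ℝ)..1, (A * G x * B) i j =
      (A * (Matrix.of fun i j => ∫ x in (-1 : ℝ)..1, G x i j) * B) i j := by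
  simp only [Matrix.mul_apply, Finset.sum_mul, Matrix.of_apply]
  have h (k l : Fin m) : IntervalIntegrable (fun x => A i k * G x k l * B l j)
      MeasureTheory.volume (-1) 1 := ((hG k l).const_mul _).mul_const _
  rw [intervalIntegral.integral_finsetSum fun l _ => by
    simpa only [Finset.sum_fn] using IntervalIntegrable.sum Finset.univ fun k _ => h k l]
  refine Finset.sum_congr rfl fun l _ => ?_
  rw [intervalIntegral.integral_finsetSum fun k _ => h k l]
  refine Finset.sum_congr rfl fun k _ => ?_
  rw [intervalIntegral.integral_mul_const, intervalIntegral.integral_const_mul]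

lemma matrixInner_add_left (hW : IsMatrixWeight W)
    (P Q R : Polynomial (Matrix (Fin m) (Fin m) ℂ)) :
    matrixInner W (P + Q) R = matrixInner W P R + matrixInner W Q R := by
  ext i j
  simp only [matrixInner, Matrix.of_apply, Matrix.add_apply, evalAt_add, Matrix.add_mul]
  exact intervalIntegral.integral_add (hW.intervalIntegrable P R i j)
    (hW.intervalIntegrable Q R i j)

lemma matrixInner_C_mul_left (hW : IsMatrixWeight W) (A : Matrix (Fin m) (Fin m) ℂ)
    (P Q : Polynomial (Matrix (Fin m) (Fin m) ℂ)) :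
    matrixInner W (Polynomial.C A * P) Q = A * matrixInner W P Q := by
  ext i j
  have h := integral_mul_mul_apply (hW.intervalIntegrable P Q) A 1 i j
  simp only [Matrix.mul_one] at h
  simp only [matrixInner, Matrix.of_apply, evalAt_C_mul, Matrix.mul_assoc] at h ⊢
  exact h

lemma matrixInner_conjTranspose (hW : IsMatrixWeight W)
    (P Q : Polynomial (Matrix (Fin m) (Fin m) ℂ)) :
    (matrixInner W P Q)ᴴ = matrixInner W Q P := by
  ext i j
  simp only [matrixInner, Matrix.of_apply, Matrix.conjTranspose_apply]
  rw [intervalIntegral.integral_of_le (by norm_num), intervalIntegral.integral_of_le (by norm_num),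
    MeasureTheory.integral_Ioc_eq_integral_Ioo, MeasureTheory.integral_Ioc_eq_integral_Ioo,
    Complex.star_def, ← integral_conj]
  refine MeasureTheory.integral_congr_ae ?_
  filter_upwards [hW.2] with x hx
  rw [← Complex.star_def, ← Matrix.conjTranspose_apply, Matrix.conjTranspose_mul,
    Matrix.conjTranspose_mul, Matrix.conjTranspose_conjTranspose, hx.1.eq, Matrix.mul_assoc]

/-- The form `matrixInner W` as an additive map in its first argument. -/
def matrixInnerLeft (hW : IsMatrixWeight W) (Q : Polynomial (Matrix (Fin m) (Fin m) ℂ)) :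
    Polynomial (Matrix (Fin m) (Fin m) ℂ) →+ Matrix (Fin m) (Fin m) ℂ :=
  AddMonoidHom.mk' (fun P => matrixInner W P Q) fun P R => matrixInner_add_left hW P R Q

lemma matrixInner_sub_left (hW : IsMatrixWeight W)
    (P Q R : Polynomial (Matrix (Fin m) (Fin m) ℂ)) :
    matrixInner W (P - Q) R = matrixInner W P R - matrixInner W Q R :=
  map_sub (matrixInnerLeft hW R) P Q

lemma matrixInner_sum_left {ι : Type} (hW : IsMatrixWeight W) (s : Finset ι)
    (P : ι → Polynomial (Matrix (Fin m) (Fin m) ℂ))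
    (Q : Polynomial (Matrix (Fin m) (Fin m) ℂ)) :
    matrixInner W (∑ i ∈ s, P i) Q = ∑ i ∈ s, matrixInner W (P i) Q :=
  map_sum (matrixInnerLeft hW Q) P s

lemma matrixInner_comm_eq_zero (hW : IsMatrixWeight W)
    {P Q : Polynomial (Matrix (Fin m) (Fin m) ℂ)} (h : matrixInner W P Q = 0) :
    matrixInner W Q P = 0 := by
  rw [← matrixInner_conjTranspose hW, h, Matrix.conjTranspose_zero]

lemma matrixInner_eq_zero_of_degree_lt (hW : IsMatrixWeight W) {d : ℕ}
    {P Q : Polynomial (Matrix (Fin m) (Fin m) ℂ)}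
    (h : ∀ e < d, matrixInner W P (Polynomial.X ^ e) = 0) (hQ : Q.degree < d) :
    matrixInner W P Q = 0 := by
  -- Matrix coefficients come out on the left of the first argument, so `Q` is moved there before it
  -- is expanded.
  apply matrixInner_comm_eq_zero hW
  rw [Q.as_sum_range_C_mul_X_pow, matrixInner_sum_left hW]
  refine Finset.sum_eq_zero fun e he => ?_
  rw [matrixInner_C_mul_left hW]
  by_cases hd : e < d
  · rw [matrixInner_comm_eq_zero hW (h e hd), mul_zero]
  · rw [Polynomial.coeff_eq_zero_of_degree_lt (hQ.trans_le (by exact_mod_cast not_lt.1 hd)),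
      zero_mul]

/-- The `i`-th diagonal entry of `P W P*` is the quadratic form of `W` at the `i`-th row of `P`. It
is nonnegative with integral zero, hence zero almost everywhere, and positivity of `W` kills the
row. Continuity extends this to all of `(-1, 1)`, which gives each entry infinitely many roots. -/
lemma eq_zero_of_matrixInner_self (hW : IsMatrixWeight W)
    {P : Polynomial (Matrix (Fin m) (Fin m) ℂ)} (h : matrixInner W P P = 0) : P = 0 := by
  have hval (x : ℝ) (i : Fin m) : (evalAt P x * W x * (evalAt P x)ᴴ) i i =
      star (star (evalAt P x i)) ⬝ᵥ (W x *ᵥ star (evalAt P x i)) := by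
    rw [star_star, Matrix.dotProduct_mulVec, Matrix.mul_apply]
    rfl
  have hzero (i j : Fin m) : matPolyEquiv.symm P i j = 0 := by
    have h1 : ∫ x in Set.Ioo (-1 : ℝ) 1,
        RCLike.re ((evalAt P x * W x * (evalAt P x)ᴴ) i i) = 0 := by
      have hi := (intervalIntegrable_iff_integrableOn_Ioo_of_le (by norm_num)).1
        (hW.intervalIntegrable P P i i)
      have h2 := congrFun (congrFun h i) i
      rw [matrixInner, Matrix.of_apply, intervalIntegral.integral_of_le (by norm_num),
        MeasureTheory.integral_Ioc_eq_integral_Ioo] at h2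
      rw [integral_re hi, h2]
      simp
    have h2 := (MeasureTheory.integral_eq_zero_iff_of_nonneg_ae (by
      filter_upwards [hW.2] with x hx
      rw [hval]
      exact (RCLike.nonneg_iff.1 (hx.posSemidef.dotProduct_mulVec_nonneg _)).1)
      ((intervalIntegrable_iff_integrableOn_Ioo_of_le (by norm_num)).1
        (hW.intervalIntegrable P P i i)).re).1 h1
    have h3 : (fun x => evalAt P x i j) =ᵐ[MeasureTheory.volume.restrict (Set.Ioo (-1 : ℝ) 1)]
        fun _ => 0 := by
      filter_upwards [hW.2, h2] with x hx hx0
      by_contra hne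
      have hv : star (evalAt P x i) ≠ 0 := by
        intro h0
        apply hne
        simpa using congrFun h0 j
      have := (RCLike.pos_iff.1 (hx.dotProduct_mulVec_pos hv)).1
      rw [← hval] at this
      exact this.ne' hx0
    have h4 := MeasureTheory.Measure.eqOn_open_of_ae_eq h3 isOpen_Ioo
      (continuous_evalAt_apply P i j).continuousOn continuousOn_const
    refine Polynomial.eq_zero_of_infinite_isRoot _ (Set.Infinite.mono ?_
      ((Set.Ioo_infinite (show (-1 : ℝ) < 1 by norm_num)).image
        Complex.ofReal_injective.injOn))
    rintro _ ⟨x, hx, rfl⟩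
    rw [Set.mem_ofPred_eq, Polynomial.IsRoot.def, ← evalAt_apply]
    exact h4 hx
  have : matPolyEquiv.symm P = 0 := by
    ext1 i j
    exact hzero i j
  simpa using this

end Inner

/-! ### Existence and uniqueness of monic orthogonal polynomials -/

section Existence

-- The positive size makes the matrix ring nontrivial, so monic polynomials are nonzero and `X ^ d`
-- has degree `d`.
variable {n : ℕ} {W : ℝ → Matrix (Fin (n + 1)) (Fin (n + 1)) ℂ}

/-- The polynomial `∑ i < d, c i x ^ i`. -/
def lowerPoly {d : ℕ} (c : Fin d → Matrix (Fin (n + 1)) (Fin (n + 1)) ℂ) :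
    Polynomial (Matrix (Fin (n + 1)) (Fin (n + 1)) ℂ) :=
  ∑ i, Polynomial.C (c i) * Polynomial.X ^ (i : ℕ)

lemma degree_lowerPoly_lt {d : ℕ} (c : Fin d → Matrix (Fin (n + 1)) (Fin (n + 1)) ℂ) :
    (lowerPoly c).degree < d := by
  refine (Polynomial.degree_sum_le _ _).trans_lt ((Finset.sup_lt_iff (by simp)).2 fun i _ => ?_)
  exact (Polynomial.degree_C_mul_X_pow_le _ _).trans_lt (by exact_mod_cast i.2)

lemma coeff_lowerPoly {d : ℕ} (c : Fin d → Matrix (Fin (n + 1)) (Fin (n + 1)) ℂ) (i : Fin d) :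
    (lowerPoly c).coeff i = c i := by
  simp only [lowerPoly, Polynomial.finsetSum_coeff, Polynomial.coeff_C_mul_X_pow]
  rw [Finset.sum_eq_single i] <;> simp +contextual [Fin.ext_iff, eq_comm]

/-- The block Gram map is a linear endomorphism of a finite dimensional space. A polynomial in its
kernel is orthogonal to everything of degree below `d`, in particular to itself, so the map is
injective and therefore surjective. -/
lemma exists_lowerPoly_matrixInner (hW : IsMatrixWeight W) (d : ℕ)
    (T : Fin d → Matrix (Fin (n + 1)) (Fin (n + 1)) ℂ) :
    ∃ c : Fin d → Matrix (Fin (n + 1)) (Fin (n + 1)) ℂ,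
      ∀ e : Fin d, matrixInner W (lowerPoly c) (Polynomial.X ^ (e : ℕ)) = T e := by
  have hval (c : Fin d → Matrix (Fin (n + 1)) (Fin (n + 1)) ℂ) (e : Fin d) :
      matrixInner W (lowerPoly c) (Polynomial.X ^ (e : ℕ)) =
        ∑ i : Fin d, c i * matrixInner W (Polynomial.X ^ (i : ℕ)) (Polynomial.X ^ (e : ℕ)) := by
    rw [lowerPoly, matrixInner_sum_left hW]
    exact Finset.sum_congr rfl fun i _ => matrixInner_C_mul_left hW _ _ _
  let L : (Fin d → Matrix (Fin (n + 1)) (Fin (n + 1)) ℂ) →ₗ[ℂ]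
      (Fin d → Matrix (Fin (n + 1)) (Fin (n + 1)) ℂ) :=
    { toFun := fun c e => ∑ i : Fin d,
        c i * matrixInner W (Polynomial.X ^ (i : ℕ)) (Polynomial.X ^ (e : ℕ))
      map_add' := fun c c' => by
        funext e
        simp [add_mul, Finset.sum_add_distrib]
      map_smul' := fun a c => by
        funext e
        simp [Finset.smul_sum] }
  have hL : Function.Injective L := by
    rw [← LinearMap.ker_eq_bot, LinearMap.ker_eq_bot']
    intro c hc
    have h0 : lowerPoly c = 0 := by
      refine eq_zero_of_matrixInner_self hW
        (matrixInner_eq_zero_of_degree_lt hW (d := d) (fun e he => ?_) (degree_lowerPoly_lt c))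
      exact (hval c ⟨e, he⟩).trans (congrFun hc ⟨e, he⟩)
    funext i
    rw [← coeff_lowerPoly c i, h0]
    simp
  obtain ⟨c, hc⟩ := LinearMap.injective_iff_surjective.1 hL T
  exact ⟨c, fun e => (hval c e).trans (congrFun hc e)⟩

lemma existsUnique_monic_orthogonal (hW : IsMatrixWeight W) (d : ℕ) :
    ∃! P : Polynomial (Matrix (Fin (n + 1)) (Fin (n + 1)) ℂ),
      (P.Monic ∧ P.natDegree = d) ∧ ∀ e < d, matrixInner W P (Polynomial.X ^ e) = 0 := by
  -- The lower order correction is chosen to cancel the products of `X ^ d` with the lower powers.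
  obtain ⟨c, hc⟩ := exists_lowerPoly_matrixInner hW d
    fun e => -matrixInner W (Polynomial.X ^ d) (Polynomial.X ^ (e : ℕ))
  refine ⟨Polynomial.X ^ d + lowerPoly c, ⟨⟨?_, ?_⟩, fun e he => ?_⟩, ?_⟩
  · exact Polynomial.monic_X_pow_add (degree_lowerPoly_lt c)
  · refine Polynomial.natDegree_eq_of_degree_eq_some ?_
    rw [Polynomial.degree_add_eq_left_of_degree_lt, Polynomial.degree_X_pow]
    rw [Polynomial.degree_X_pow]
    exact degree_lowerPoly_lt c
  · rw [matrixInner_add_left hW, hc ⟨e, he⟩, add_neg_cancel]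
  · rintro Q ⟨⟨hQm, hQd⟩, hQ⟩
    have hXd : (Polynomial.X ^ d + lowerPoly c).degree = (d : WithBot ℕ) := by
      rw [Polynomial.degree_add_eq_left_of_degree_lt, Polynomial.degree_X_pow]
      rw [Polynomial.degree_X_pow]
      exact degree_lowerPoly_lt c
    have hQdeg : Q.degree = (d : WithBot ℕ) := by rw [Polynomial.degree_eq_natDegree hQm.ne_zero, hQd]
    -- The leading terms cancel, so the difference of two solutions has degree below `d` and is
    -- orthogonal to itself.
    have hlt : (Q - (Polynomial.X ^ d + lowerPoly c)).degree < (d : WithBot ℕ) := by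
      rw [← hQdeg]
      refine Polynomial.degree_sub_lt_left (hQdeg.trans hXd.symm) hQm.ne_zero ?_
      rw [hQm.leadingCoeff, (Polynomial.monic_X_pow_add (degree_lowerPoly_lt c)).leadingCoeff]
    refine sub_eq_zero.1 (eq_zero_of_matrixInner_self hW
      (matrixInner_eq_zero_of_degree_lt hW (fun e he => ?_) hlt))
    rw [matrixInner_sub_left hW, hQ e he, matrixInner_add_left hW, hc ⟨e, he⟩, add_neg_cancel,
      sub_zero]

/-- Decouples the degrees: mutual orthogonality of the sequence becomes a condition on each `P d`
alone, so that existence and uniqueness can be settled one degree at a time. -/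
lemma isMonicMVOP_iff (hW : IsMatrixWeight W)
    (P : ℕ → Polynomial (Matrix (Fin (n + 1)) (Fin (n + 1)) ℂ)) :
    IsMonicMVOP W P ↔ ∀ d, ((P d).Monic ∧ (P d).natDegree = d) ∧
      ∀ e < d, matrixInner W (P d) (Polynomial.X ^ e) = 0 := by
  constructor
  · rintro ⟨hP, hPo⟩ d
    refine ⟨hP d, fun e => ?_⟩
    -- `P e - X ^ e` has degree below `e`, so `P d` is orthogonal to it by induction and to `P e` by
    -- assumption.
    induction e using Nat.strong_induction_on with
    | _ e ih =>
      intro he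
      have hPdeg : (P e).degree = (e : WithBot ℕ) := by
        rw [Polynomial.degree_eq_natDegree (hP e).1.ne_zero, (hP e).2]
      have hlt : (P e - Polynomial.X ^ e).degree < (e : WithBot ℕ) := by
        rw [← hPdeg]
        refine Polynomial.degree_sub_lt_left ?_ (hP e).1.ne_zero ?_
        · rw [hPdeg, Polynomial.degree_X_pow]
        · rw [(hP e).1.leadingCoeff, (Polynomial.monic_X_pow e).leadingCoeff]
      have h := matrixInner_comm_eq_zero hW (matrixInner_eq_zero_of_degree_lt hW
        (fun k hk => ih k hk (hk.trans he)) hlt)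
      rw [matrixInner_sub_left hW, matrixInner_comm_eq_zero hW (hPo d e he.ne'), zero_sub,
        neg_eq_zero] at h
      exact matrixInner_comm_eq_zero hW h
  · intro h
    have hlt (d e : ℕ) (hed : e < d) : matrixInner W (P d) (P e) = 0 := by
      refine matrixInner_eq_zero_of_degree_lt hW (h d).2 ?_
      rw [Polynomial.degree_eq_natDegree (h e).1.1.ne_zero, (h e).1.2]
      exact_mod_cast hed
    refine ⟨fun d => (h d).1, fun d e hde => ?_⟩
    rcases lt_or_gt_of_ne hde with hde | hde
    · exact matrixInner_comm_eq_zero hW (hlt e d hde)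
    · exact hlt d e hde

/-- A matrix weight has a unique sequence of monic orthogonal polynomials. -/
lemma existsUnique_isMonicMVOP (hW : IsMatrixWeight W) :
    ∃! P : ℕ → Polynomial (Matrix (Fin (n + 1)) (Fin (n + 1)) ℂ), IsMonicMVOP W P := by
  choose P hP hPu using existsUnique_monic_orthogonal hW
  refine ⟨P, (isMonicMVOP_iff hW P).2 hP, fun Q hQ => ?_⟩
  funext d
  exact hPu d (Q d) ((isMonicMVOP_iff hW Q).1 hQ d)

end Existence

/-! ### The reflection from `W₁` to `W₂` -/

lemma coeff_reflectPoly {m : ℕ} (d k : ℕ) (P : Polynomial (Matrix (Fin m) (Fin m) ℂ)) :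
    (reflectPoly d P).coeff k = (-1) ^ d * (matJ m * matF m * (P.coeff k * (-1) ^ k) *
      (matF m * matJ m)) := by
  have h1 : (-1 : Polynomial (Matrix (Fin m) (Fin m) ℂ)) ^ d =
      Polynomial.C ((-1) ^ d) := by simp
  have h2 : (-Polynomial.X : Polynomial (Matrix (Fin m) (Fin m) ℂ)) =
      Polynomial.C (-1) * Polynomial.X := by
    rw [Polynomial.C_neg, Polynomial.C_1]
    exact (neg_one_mul (Polynomial.X : Polynomial (Matrix (Fin m) (Fin m) ℂ))).symm
  rw [reflectPoly, h1, h2, Polynomial.coeff_C_mul, Polynomial.coeff_mul_C, Polynomial.coeff_C_mul,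
    Polynomial.comp_C_mul_X_coeff]

lemma matJ_mul_matF_mul_matF_mul_matJ (m : ℕ) : matJ m * matF m * (matF m * matJ m) = 1 := by
  rw [Matrix.mul_assoc, ← Matrix.mul_assoc (matF m), matF_mul_matF, Matrix.one_mul, matJ_mul_matJ]

/-- At degree `d` the sign from `P(-x)` cancels the prefactor `(-1)^d`, and `JF · FJ = 1`. -/
lemma reflectPoly_monic {n d : ℕ} {P : Polynomial (Matrix (Fin (n + 1)) (Fin (n + 1)) ℂ)}
    (hP : P.Monic) (hd : P.natDegree = d) :
    (reflectPoly d P).Monic ∧ (reflectPoly d P).natDegree = d := by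
  have h1 : (reflectPoly d P).coeff d = 1 := by
    rw [coeff_reflectPoly, ← hd, hP.coeff_natDegree, one_mul]
    rcases neg_one_pow_eq_or (Matrix (Fin (n + 1)) (Fin (n + 1)) ℂ) P.natDegree with h | h <;>
      simp [h, matJ_mul_matF_mul_matF_mul_matJ]
  have h2 : (reflectPoly d P).natDegree ≤ d := by
    rw [Polynomial.natDegree_le_iff_coeff_eq_zero]
    intro k hk
    rw [coeff_reflectPoly, Polynomial.coeff_eq_zero_of_natDegree_lt (hd.trans_lt hk)]
    simp
  refine ⟨Polynomial.monic_of_natDegree_le_of_coeff_eq_one d h2 h1,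
    h2.antisymm (Polynomial.le_natDegree_of_ne_zero ?_)⟩
  rw [h1]
  exact one_ne_zero

/-- Reflection is conjugation by the unitary `JF` together with `x ↦ -x`. The inner factors `FJ ·
JF` cancel, and the interval is symmetric, so only constant outer factors remain and orthogonality
is preserved. -/
lemma matrixInner_weightTwo_reflectPoly (n d e : ℕ)
    (P Q : Polynomial (Matrix (Fin (n + 1)) (Fin (n + 1)) ℂ)) :
    matrixInner (weightTwo n) (reflectPoly d P) (reflectPoly e Q) =
      ((-1) ^ d * (matJ (n + 1) * matF (n + 1))) * matrixInner (weightOne n) P Q *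
        (matF (n + 1) * matJ (n + 1) * (-1) ^ e) := by
  ext i j
  rw [matrixInner, matrixInner, Matrix.of_apply,
    ← integral_mul_mul_apply ((isMatrixWeight_weightOne n).intervalIntegrable P Q)]
  have h := intervalIntegral.integral_comp_neg (a := (-1 : ℝ)) (b := 1) fun x =>
    (((-1) ^ d * (matJ (n + 1) * matF (n + 1))) *
      (evalAt P x * weightOne n x * (evalAt Q x)ᴴ) *
        (matF (n + 1) * matJ (n + 1) * (-1) ^ e)) i j
  rw [neg_neg] at h
  rw [← h]
  refine intervalIntegral.integral_congr fun x _ => ?_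
  have hJ (X : Matrix (Fin (n + 1)) (Fin (n + 1)) ℂ) : matJ (n + 1) * (matJ (n + 1) * X) = X := by
    rw [← Matrix.mul_assoc, matJ_mul_matJ, Matrix.one_mul]
  have hF (X : Matrix (Fin (n + 1)) (Fin (n + 1)) ℂ) : matF (n + 1) * (matF (n + 1) * X) = X := by
    rw [← Matrix.mul_assoc, matF_mul_matF, Matrix.one_mul]
  simp only [evalAt_reflectPoly, weightTwo, Matrix.conjTranspose_mul, matJ_conjTranspose,
    matF_conjTranspose, Matrix.conjTranspose_pow, Matrix.conjTranspose_neg,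
    Matrix.conjTranspose_one, Matrix.mul_assoc, hJ, hF]

lemma isMonicMVOP_reflectPoly {n : ℕ}
    {P : ℕ → Polynomial (Matrix (Fin (n + 1)) (Fin (n + 1)) ℂ)}
    (hP : IsMonicMVOP (weightOne n) P) :
    IsMonicMVOP (weightTwo n) fun d => reflectPoly d (P d) := by
  refine ⟨fun d => reflectPoly_monic (hP.1 d).1 (hP.1 d).2, fun d e hde => ?_⟩
  rw [matrixInner_weightTwo_reflectPoly, hP.2 d e hde, mul_zero, zero_mul]

end SU2MVOP

end

theorem mainTheorem10 (n : ℕ) :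
    (∀ x ∈ Set.Icc (-1 : ℝ) 1,
      (SU2MVOP.blockA n x)ᵀ = SU2MVOP.blockA n x ∧
      SU2MVOP.evenW n x =
        Matrix.fromBlocks (SU2MVOP.blockA n x) (SU2MVOP.blockB n x)
          (SU2MVOP.antiTranspose (SU2MVOP.blockB n x))ᵀ
          (SU2MVOP.antiTranspose (SU2MVOP.blockA n x))ᵀ ∧
      SU2MVOP.matY n * SU2MVOP.evenW n x * (SU2MVOP.matY n)ᵀ =
        Matrix.fromBlocks (SU2MVOP.weightOne n x) 0 0 (SU2MVOP.weightTwo n x)) ∧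
    SU2MVOP.IsMatrixWeight (SU2MVOP.weightOne n) ∧
    SU2MVOP.IsMatrixWeight (SU2MVOP.weightTwo n) ∧
    (∃! P₁ : ℕ → Polynomial (Matrix (Fin (n + 1)) (Fin (n + 1)) ℂ),
      SU2MVOP.IsMonicMVOP (SU2MVOP.weightOne n) P₁) ∧
    (∀ P₁ : ℕ → Polynomial (Matrix (Fin (n + 1)) (Fin (n + 1)) ℂ),
      SU2MVOP.IsMonicMVOP (SU2MVOP.weightOne n) P₁ →
      ∀ P₂ : ℕ → Polynomial (Matrix (Fin (n + 1)) (Fin (n + 1)) ℂ),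
        SU2MVOP.IsMonicMVOP (SU2MVOP.weightTwo n) P₂ ↔
          P₂ = fun d => SU2MVOP.reflectPoly d (P₁ d)) := by
  refine ⟨fun x _ => ⟨SU2MVOP.blockA_transpose n x, SU2MVOP.evenW_eq_fromBlocks n x,
      SU2MVOP.matY_mul_evenW_mul_transpose n x⟩, SU2MVOP.isMatrixWeight_weightOne n,
    SU2MVOP.isMatrixWeight_weightTwo n,
    SU2MVOP.existsUnique_isMonicMVOP (SU2MVOP.isMatrixWeight_weightOne n), fun P₁ hP₁ P₂ => ?_⟩
  have h := SU2MVOP.isMonicMVOP_reflectPoly hP₁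
  refine ⟨fun hP₂ => ?_, fun hP₂ => hP₂ ▸ h⟩
  exact (SU2MVOP.existsUnique_isMonicMVOP (SU2MVOP.isMatrixWeight_weightTwo n)).unique hP₂ h
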